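/- Conventions. Fix a polynomially bounded o-minimal expansion of the ordered field $\mathbb R$ (polynomially bounded: for every definable $f:\mathbb R\to\mathbb R$ there are $n\in\mathbb N$ and $C\in\mathbb R$ with $f(x)<x^n$ for all $x>C$). For $a\in\mathbb R^m$ and $S\subset\mathbb R^m$ let $d(a,S)$ be the Euclidean distance, with the convention $d(a,\emptyset)=1$. A stratification $\mathcal X=(X^i)_{i=0}^m$ of a set $X\subset\mathbb R^m$ definable with parameters is given by a finite partition $\mathcal C$ of $X$ into definable $C^2$ cells such that the closure in $X$ of each $C\in\mathcal C$ is a union of cells of $\mathcal C$; $X^i$ is the union of the cells of dimension at most $i$, $\mathring X^i$ is the union of the cells of dimension $i$, and $X^{-1}=\emptyset$. For $x\in\mathring X^i$, $P_x$ is the orthogonal projection of $\mathbb R^m$ onto $T_x\mathring X^i$. Let $c,c',C,C'>0$. A plain $(c,c',C,C')$-chain is a sequence $(a_i)_{i=0}^k$ with $a_i\in\mathring X^{j_i}$, $j_0>j_1>\dots>j_k$, such that $|a_0-a_i|<c\,d(a_0,X^{j_i})$ for $1\le i\le k$, $d(a_0,X^{j_i-1})>C\,d(a_0,X^{j_i})$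 for $0\le i\le k$, and $d(a_0,X^{j-1})<c'\,d(a_0,X^{j})$ for every $0\le j<j_0$ not among the $j_i$. An augmented $(c,c',C,C')$-chain is a sequence $(a_i)_{i=0}^k$, $k\ge1$, with $a_i\in\mathring X^{j_i}$, $j_0=j_1>j_2>\dots>j_k$, such that $|a_0-a_i|<c\,d(a_0,X^{j_i})$ and $d(a_0,X^{j_i-1})>C\,d(a_0,X^{j_i})$ for $2\le i\le k$, $d(a_0,X^{j-1})<c'\,d(a_0,X^{j})$ for every $0\le j<j_0$ not among the $j_i$, and $|a_0-a_1|<(C')^{-1}d(a_0,X^{j_0-1})$. The stratification is $(c,c',C,C',C'')$-Lipschitz if, in the operator norm, $$|(1-P_{a_0})P_{a_1}\cdots P_{a_s}|\le C''\,\frac{|a_0-a_1|}{d(a_0,X^{j_s-1})}\qquad(1\le s\le k)$$ for every plain $(c,c',C,C')$-chain, and $$|(P_{a_0}-P_{a_1})P_{a_2}\cdots P_{a_s}|\le C''\,\frac{|a_0-a_1|}{d(a_0,X^{j_s-1})}\qquad(1\le s\le k)$$ for every augmented $(c,c',C,C')$-chain. It is a Lipschitz stratification if for every $c>0$ there is $C>0$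 such that it is $(c,c,C,C,C)$-Lipschitz. A set $B\subset\mathbb R^m$ is a $C^2$ embedded submanifold with corners of codimension one if for each $p\in B$ there is, for some $l$, a $C^2$ diffeomorphism between open subsets of $\mathbb R^m$, defined near $p$ and taking $p$ to $0$, under which $B$ becomes the set of points at which one chosen coordinate vanishes and $l$ chosen other coordinates are nonnegative; then $p$ is an $l$-corner of $B$. The set of $l$-corners is denoted $\partial_l B$ (it has codimension $l+1$ in $\mathbb R^m$). Statement. Suppose $\mathcal X=(X^i)_{i=0}^m$ is a Lipschitz stratification of a closed set $X\subset\mathbb R^m$ definable with parameters, and $U\subset\mathbb R^m$ is open and definable with parameters. Suppose that the topological boundary $\partial U$ is compact and is a $C^2$ embedded submanifold with corners of codimension one in $\mathbb R^m$, and that for all $l,i\le m$ the set $\partial_l\partial U$ of $l$-corners intersects $\mathring X^i$ transversely. Let $\mathcal Y=(Y^k)_{k=0}^m$, $Y^k=U\cap X^k$, be the stratification of $U\cap X$ induced by $\mathcal X$. Then there is a real constant $Q$ such that $d(x,Y^k)\le Q\,d(x,X^k)$ for all $x\in U\cap X$ and all $k\le m$. -/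

import Mathlib

open Set

universe u v

/-- Euclidean space `ℝ^m`. -/
abbrev Euc (m : ℕ) : Type := EuclideanSpace ℝ (Fin m)

/-! ### Definability -/

section Definability

variable (L : FirstOrder.Language.{u, v}) [L.Structure ℝ]

/-- A subset of `ℝ^m` is definable with parameters. -/
def DefinableSet {m : ℕ} (X : Set (Euc m)) : Prop :=
  (Set.univ : Set ℝ).Definable L {x : Fin m → ℝ | WithLp.toLp 2 x ∈ X}

/-- The function `f`, restricted to `C`, is definable with parameters (that is, its graph over `C`
is). -/
def DefinableFunOn {n : ℕ} (f : (Fin n → ℝ) → ℝ) (C : Set (Fin n → ℝ)) : Prop :=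
  (Set.univ : Set ℝ).Definable L
    {x : Fin (n + 1) → ℝ | Fin.init x ∈ C ∧ x (Fin.last n) = f (Fin.init x)}

/-- The `L`-structure on `ℝ` is a polynomially bounded o-minimal expansion of the ordered field of
real numbers. -/
structure IsPolyBoundedOMinimal : Prop where
  add_definable : (∅ : Set ℝ).Definable L {x : Fin 3 → ℝ | x 0 + x 1 = x 2}
  mul_definable : (∅ : Set ℝ).Definable L {x : Fin 3 → ℝ | x 0 * x 1 = x 2}
  lt_definable : (∅ : Set ℝ).Definable L {x : Fin 2 → ℝ | x 0 < x 1}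
  /-- every subset of the line that is definable with parameters is a finite union of intervals
  (order-connected sets: points, and intervals of any kind) -/
  ominimal : ∀ S : Set ℝ, (Set.univ : Set ℝ).Definable₁ L S →
    ∃ F : Set (Set ℝ), F.Finite ∧ (∀ I ∈ F, I.OrdConnected) ∧ S = ⋃₀ F
  poly_bounded : ∀ f : ℝ → ℝ, (∅ : Set ℝ).Definable L {x : Fin 2 → ℝ | x 1 = f (x 0)} →
    ∃ (n : ℕ) (C : ℝ), ∀ x > C, f x < x ^ n

/-- `IsC2CellCoord L n d C`: the set `C ⊆ ℝ^n` is a definable `C²` cell of dimension `d`. Cells are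
built one coordinate at a time, as graphs of definable `C²` functions on a cell, and as open bands
between two such functions, where the lower one may be `-∞` and the upper one `+∞`.
`ContDiffOn` on a cell that is not open means here, equivalently, that the function extends
to a `C²` function on an open neighbourhood of the cell. -/
inductive IsC2CellCoord : (n : ℕ) → ℕ → Set (Fin n → ℝ) → Prop
  | point : IsC2CellCoord 0 0 Set.univ
  | graph {n d : ℕ} {C : Set (Fin n → ℝ)} (f : (Fin n → ℝ) → ℝ) (hC : IsC2CellCoord n d C)
      (hf : ContDiffOn ℝ 2 f C) (hf' : DefinableFunOn L f C) :
      IsC2CellCoord (n + 1) d {x | Fin.init x ∈ C ∧ x (Fin.last n) = f (Fin.init x)}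
  | band {n d : ℕ} {C : Set (Fin n → ℝ)} (f g : (Fin n → ℝ) → ℝ) (hC : IsC2CellCoord n d C)
      (hf : ContDiffOn ℝ 2 f C) (hf' : DefinableFunOn L f C)
      (hg : ContDiffOn ℝ 2 g C) (hg' : DefinableFunOn L g C) (hfg : ∀ x ∈ C, f x < g x) :
      IsC2CellCoord (n + 1) (d + 1)
        {x | Fin.init x ∈ C ∧ f (Fin.init x) < x (Fin.last n) ∧ x (Fin.last n) < g (Fin.init x)}
  | bandAbove {n d : ℕ} {C : Set (Fin n → ℝ)} (f : (Fin n → ℝ) → ℝ) (hC : IsC2CellCoord n d C)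
      (hf : ContDiffOn ℝ 2 f C) (hf' : DefinableFunOn L f C) :
      IsC2CellCoord (n + 1) (d + 1) {x | Fin.init x ∈ C ∧ f (Fin.init x) < x (Fin.last n)}
  | bandBelow {n d : ℕ} {C : Set (Fin n → ℝ)} (g : (Fin n → ℝ) → ℝ) (hC : IsC2CellCoord n d C)
      (hg : ContDiffOn ℝ 2 g C) (hg' : DefinableFunOn L g C) :
      IsC2CellCoord (n + 1) (d + 1) {x | Fin.init x ∈ C ∧ x (Fin.last n) < g (Fin.init x)}
  | cylinder {n d : ℕ} {C : Set (Fin n → ℝ)} (hC : IsC2CellCoord n d C) :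
      IsC2CellCoord (n + 1) (d + 1) {x | Fin.init x ∈ C}

/-- The subset `c` of Euclidean space `ℝ^m` is a definable `C²` cell of dimension `d`. -/
def IsC2Cell {m : ℕ} (d : ℕ) (c : Set (Euc m)) : Prop :=
  IsC2CellCoord L m d {x : Fin m → ℝ | WithLp.toLp 2 x ∈ c}

/-- A stratification of `X`: a finite partition of `X` into definable `C²` cells such that the
closure in `X` of every cell is a union of cells. -/
structure Stratification {m : ℕ} (X : Set (Euc m)) where
  cells : Set (Set (Euc m))
  finite : cells.Finite
  isCell : ∀ c ∈ cells, ∃ d, IsC2Cell L d c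
  disjoint : cells.PairwiseDisjoint id
  sUnion_eq : ⋃₀ cells = X
  closure_eq : ∀ c ∈ cells, ∃ D ⊆ cells, closure c ∩ X = ⋃₀ D

end Definability

/-! ### Distances and tangent spaces -/

/-- The distance `d(a, S)` from a point to a set, with the convention `d(a, ∅) = 1`. -/
noncomputable def setDist {m : ℕ} (a : Euc m) (S : Set (Euc m)) : ℝ :=
  open Classical in if S = ∅ then 1 else Metric.infDist a S

/-- The tangent space at `x` of an embedded submanifold `S` of `ℝ^m` (for which the tangent
cone is already a linear subspace). -/
noncomputable def tangentSpaceOf {m : ℕ} (S : Set (Euc m)) (x : Euc m) : Submodule ℝ (Euc m) :=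
  Submodule.span ℝ (tangentConeAt ℝ S x)

/-- The embedded submanifolds `S` and `T` of `ℝ^m` intersect transversely. -/
def TransverseSets {m : ℕ} (S T : Set (Euc m)) : Prop :=
  ∀ p ∈ S ∩ T, tangentSpaceOf S p ⊔ tangentSpaceOf T p = ⊤

/-! ### Lipschitz stratifications -/

namespace Stratification

variable {L : FirstOrder.Language.{u, v}} [L.Structure ℝ] {m : ℕ} {X : Set (Euc m)}

/-- The skeleton `X^k`: the union of the cells of dimension at most `k`; so `X^(-1) = ∅`. -/
def skel (𝒳 : Stratification L X) (k : ℤ) : Set (Euc m) :=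
  ⋃₀ {c | c ∈ 𝒳.cells ∧ ∃ d : ℕ, (d : ℤ) ≤ k ∧ IsC2Cell L d c}

/-- The union of the cells of dimension `i`. -/
def stratum (𝒳 : Stratification L X) (i : ℕ) : Set (Euc m) :=
  ⋃₀ {c | c ∈ 𝒳.cells ∧ IsC2Cell L i c}

/-- The skeleton `Y^k` of the stratification that `𝒳` induces on `U ∩ X`. -/
def inducedSkel (𝒳 : Stratification L X) (U : Set (Euc m)) (k : ℤ) : Set (Euc m) :=
  U ∩ 𝒳.skel k

/-- The orthogonal projection of `ℝ^m` onto the tangent space at `x` of the stratum of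
dimension `i`, for `x` in that stratum. -/
noncomputable def proj (𝒳 : Stratification L X) (i : ℕ) (x : Euc m) : Euc m →L[ℝ] Euc m :=
  (tangentSpaceOf (𝒳.stratum i) x).starProjection

/-- `a 0, …, a k`, with `a i` in the stratum of dimension `j i`, is a plain `(c, c', C)`-chain. -/
structure IsPlainChain (𝒳 : Stratification L X) (c c' C : ℝ) (k : ℕ) (a : ℕ → Euc m)
    (j : ℕ → ℕ) : Prop where
  mem : ∀ i ≤ k, a i ∈ 𝒳.stratum (j i)
  strictAnti : ∀ i i', i < i' → i' ≤ k → j i' < j i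
  near : ∀ i, 1 ≤ i → i ≤ k → dist (a 0) (a i) < c * setDist (a 0) (𝒳.skel (j i))
  jump : ∀ i ≤ k, C * setDist (a 0) (𝒳.skel (j i)) < setDist (a 0) (𝒳.skel ((j i : ℤ) - 1))
  no_jump : ∀ l < j 0, (∀ i ≤ k, j i ≠ l) →
    setDist (a 0) (𝒳.skel ((l : ℤ) - 1)) < c' * setDist (a 0) (𝒳.skel l)

/-- `a 0, …, a k`, with `a i` in the stratum of dimension `j i`, is an augmented
`(c, c', C, C')`-chain. -/
structure IsAugmentedChain (𝒳 : Stratification L X) (c c' C C' : ℝ) (k : ℕ) (a : ℕ → Euc m)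
    (j : ℕ → ℕ) : Prop where
  one_le : 1 ≤ k
  mem : ∀ i ≤ k, a i ∈ 𝒳.stratum (j i)
  strictAnti : ∀ i i', 1 ≤ i → i < i' → i' ≤ k → j i' < j i
  eq_first : j 0 = j 1
  near : ∀ i, 1 < i → i ≤ k → dist (a 0) (a i) < c * setDist (a 0) (𝒳.skel (j i))
  jump : ∀ i, 1 < i → i ≤ k →
    C * setDist (a 0) (𝒳.skel (j i)) < setDist (a 0) (𝒳.skel ((j i : ℤ) - 1))
  no_jump : ∀ l < j 0, (∀ i ≤ k, j i ≠ l) →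
    setDist (a 0) (𝒳.skel ((l : ℤ) - 1)) < c' * setDist (a 0) (𝒳.skel l)
  near_first : dist (a 0) (a 1) < C'⁻¹ * setDist (a 0) (𝒳.skel ((j 0 : ℤ) - 1))

/-- The product `P_{a r} P_{a (r+1)} ⋯ P_{a (r+n-1)}` of `n` consecutive projections. -/
noncomputable def projProd (𝒳 : Stratification L X) (a : ℕ → Euc m) (j : ℕ → ℕ) (r n : ℕ) :
    Euc m →L[ℝ] Euc m :=
  ((List.range' r n).map fun i => 𝒳.proj (j i) (a i)).prod

/-- The `(c, c', C, C', C'')`-Lipschitz condition, in the operator norm. -/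
def IsLipschitzWith (𝒳 : Stratification L X) (c c' C C' C'' : ℝ) : Prop :=
  (∀ (k : ℕ) (a : ℕ → Euc m) (j : ℕ → ℕ), 𝒳.IsPlainChain c c' C k a j →
    ∀ s, 1 ≤ s → s ≤ k →
      ‖(1 - 𝒳.proj (j 0) (a 0)) * 𝒳.projProd a j 1 s‖ ≤
        C'' * (dist (a 0) (a 1) / setDist (a 0) (𝒳.skel ((j s : ℤ) - 1)))) ∧
  (∀ (k : ℕ) (a : ℕ → Euc m) (j : ℕ → ℕ), 𝒳.IsAugmentedChain c c' C C' k a j →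
    ∀ s, 1 ≤ s → s ≤ k →
      ‖(𝒳.proj (j 0) (a 0) - 𝒳.proj (j 1) (a 1)) * 𝒳.projProd a j 2 (s - 1)‖ ≤
        C'' * (dist (a 0) (a 1) / setDist (a 0) (𝒳.skel ((j s : ℤ) - 1))))

/-- Lipschitz stratifications. -/
def IsLipschitz (𝒳 : Stratification L X) : Prop :=
  ∀ c > 0, ∃ C > 0, 𝒳.IsLipschitzWith c c C C C

end Stratification

/-! ### Hypersurfaces with corners -/

/-- The set `∂_l B` of `l`-corners of `B ⊆ ℝ^m`: the points `p` at which some `C²` diffeomorphism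
`Φ` between open subsets of `ℝ^m` takes `p` to `0`, and takes `B` to the set of points of the
hyperplane `y i₀ = 0` at which `l` of the other coordinates are nonnegative. -/
def cornerSet {m : ℕ} (B : Set (Euc m)) (l : ℕ) : Set (Euc m) :=
  {p | ∃ (Φ : OpenPartialHomeomorph (Euc m) (Euc m)) (i₀ : Fin m) (J : Finset (Fin m)),
    p ∈ Φ.source ∧ Φ p = 0 ∧
    ContDiffOn ℝ 2 Φ Φ.source ∧ ContDiffOn ℝ 2 Φ.symm Φ.target ∧
    i₀ ∉ J ∧ J.card = l ∧
    ∀ x ∈ Φ.source, x ∈ B ↔ Φ x i₀ = 0 ∧ ∀ j ∈ J, 0 ≤ Φ x j}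

/-- `B` is a `C²` embedded submanifold with corners of codimension one in `ℝ^m`. -/
def IsC2HypersurfaceWithCorners {m : ℕ} (B : Set (Euc m)) : Prop :=
  ∀ p ∈ B, ∃ l, p ∈ cornerSet B l

/-! The danger is that a point $x\in U$ has a nearest point $y$ of $X^k$ outside $U$ while $U\cap
X^k$ is much farther away. By compactness of $\partial U$ it suffices to treat $x$ and $y$ near one
boundary point $p$. If $p$ lies in the $i$-dimensional stratum, $i\le k$, transversality provides a
vector $v$ tangent to that stratum along which a local defining function $h$ of the hypersurface has
nonzero derivative (`exists_dist_le_local`). Starting at $y$, a move of length $O(|x-y|)$ along $v$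
or $-v$ enters $U$; if this can be done almost inside $X^k$, the endpoint can be corrected to a
point of $U\cap X^k$ at distance $O(|x-y|)$ from $x$ (`exists_dist_le_of_side`).

That $X^k$ is almost invariant under small moves along $v$ is `exists_dist_add_smul_le`: the
distance from $y+sv$ to $X^k$ grows at rate at most $\varepsilon$, because its nearest point can be
moved along its own stratum with velocity the projection of $v$. This needs Whitney's condition (a),
`exists_norm_sub_proj_le`, which the Lipschitz inequalities on plain chains imply; disjoint windows
of constants and the pigeonhole principle ensure that every point starts an admissible chain.

All this requires closed skeletons and strata that are locally single cells. Both come from the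
frontier inequality for cells, `IsC2CellCoord.not_subset_closure`, proved from o-minimality by Baire
category and an equidimensional Sard argument. -/

/-! ### Definable sets: order, boxes, fibres, countable implies finite. -/

section DefinableSets

open FirstOrder

variable {L : FirstOrder.Language.{u, v}} [L.Structure ℝ]

theorem definable_setOf_lt (hL : IsPolyBoundedOMinimal L) {α : Type*} (i j : α) :
    (univ : Set ℝ).Definable L {x : α → ℝ | x i < x j} := by
  have h := (hL.lt_definable.mono (subset_univ _)).preimage_comp ![i, j]
  simpa using h

theorem definable_setOf_eq_const {α : Type*} (i : α) (c : ℝ) :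
    (univ : Set ℝ).Definable L {x : α → ℝ | x i = c} := by
  have h : (univ : Set ℝ).Definable₁ L {c} := Set.Definable.singleton_of_mem L (mem_univ c)
  have h' := Set.Definable.preimage_comp (fun _ : Fin 1 => i) h
  simpa using h'

theorem definable_setOf_lt_const (hL : IsPolyBoundedOMinimal L) {α : Type*} (i : α) (c : ℝ) :
    (univ : Set ℝ).Definable L {x : α → ℝ | x i < c} := by
  have h := ((definable_setOf_lt hL (0 : Fin 2) 1).inter
    (definable_setOf_eq_const (L := L) (1 : Fin 2) c)).image_comp (fun _ : Fin 1 => (0 : Fin 2))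
  have h' := h.preimage_comp (fun _ : Fin 1 => i)
  convert h' using 1
  ext x
  simp only [mem_ofPred_eq, mem_preimage, mem_image, mem_inter_iff]
  constructor
  · intro hx
    exact ⟨![x i, c], ⟨by simpa using hx, by simp⟩, by ext; simp⟩
  · rintro ⟨y, ⟨h1, h2⟩, h3⟩
    have : y 0 = x i := congrFun h3 0
    rw [← this, ← h2]; exact h1

theorem definable_setOf_const_lt (hL : IsPolyBoundedOMinimal L) {α : Type*} (i : α) (c : ℝ) :
    (univ : Set ℝ).Definable L {x : α → ℝ | c < x i} := by
  convert (definable_setOf_lt_const hL i c).compl.inter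
    (definable_setOf_eq_const (L := L) i c).compl using 1
  ext x
  simp only [mem_ofPred_eq, mem_inter_iff, mem_compl_iff, not_lt]
  exact ⟨fun h => ⟨h.le, h.ne'⟩, fun h => lt_of_le_of_ne h.1 (Ne.symm h.2)⟩

theorem definable_Icc (hL : IsPolyBoundedOMinimal L) {α : Type*} [Finite α] (a b : α → ℝ) :
    (univ : Set ℝ).Definable L (Icc a b) := by
  have h : ∀ i : α, (univ : Set ℝ).Definable L ({x : α → ℝ | x i < a i}ᶜ ∩ {x | b i < x i}ᶜ) :=
    fun i => (definable_setOf_lt_const hL i (a i)).compl.inter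
      (definable_setOf_const_lt hL i (b i)).compl
  convert Set.definable_iInter_of_finite h using 1
  ext x
  simp [Pi.le_def, forall_and]

theorem definable_setOf_mem_Icc (hL : IsPolyBoundedOMinimal L) {α : Type*} (i : α)
    (a b : ℝ) : (univ : Set ℝ).Definable L {x : α → ℝ | x i ∈ Icc a b} := by
  convert (definable_setOf_lt_const hL i a).compl.inter
      (definable_setOf_const_lt hL i b).compl using 1
  ext x
  simp

/-- The set of values of one coordinate on a definable set. -/
theorem definable₁_image_apply {α : Type*} [Finite α] {S : Set (α → ℝ)}
    (hS : (univ : Set ℝ).Definable L S) (i : α) :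
    (univ : Set ℝ).Definable₁ L ((fun x : α → ℝ => x i) '' S) := by
  have h := hS.image_comp (fun _ : Fin 1 => i)
  unfold Set.Definable₁
  convert h using 1
  ext x
  simp only [mem_ofPred_eq, mem_image]
  constructor
  · rintro ⟨y, hy, h⟩
    exact ⟨y, hy, by ext j; rw [Subsingleton.elim j 0]; exact h⟩
  · rintro ⟨y, hy, h⟩
    exact ⟨y, hy, congrFun h 0⟩

theorem definable_fiber {α β : Type*} [Finite β] {S : Set (α → ℝ)}
    (hS : (univ : Set ℝ).Definable L S) (q : β → α) (u : β → ℝ) :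
    (univ : Set ℝ).Definable L (S ∩ {x | ∀ j, x (q j) = u j}) := by
  convert hS.inter (Set.definable_iInter_of_finite
    fun j => definable_setOf_eq_const (L := L) (q j) (u j)) using 2
  ext x
  simp

/-- A countable definable subset of the line is finite. -/
theorem finite_of_definable₁ (hL : IsPolyBoundedOMinimal L) {S : Set ℝ}
    (hS : (univ : Set ℝ).Definable₁ L S)
    (h : ∀ a b : ℝ, a < b → ¬ Icc a b ⊆ S) : S.Finite := by
  obtain ⟨F, hF, hconn, rfl⟩ := hL.ominimal S hS
  refine hF.sUnion fun I hI => Set.Subsingleton.finite ?_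
  intro x hx y hy
  by_contra hne
  rcases lt_or_gt_of_ne hne with hlt | hlt
  · exact h x y hlt (((hconn I hI).out hx hy).trans (subset_sUnion_of_mem hI))
  · exact h y x hlt (((hconn I hI).out hy hx).trans (subset_sUnion_of_mem hI))

theorem not_countable_Icc {a b : ℝ} (hab : a < b) : ¬ (Icc a b).Countable := fun h => by
  have h' := Cardinal.le_aleph0_iff_set_countable.2 h
  rw [Cardinal.mk_Icc_real hab] at h'
  exact absurd h' (not_le.2 Cardinal.aleph0_lt_continuum)

/-- Each coordinate takes a definable, countable set of values; this set contains no interval, so it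
is finite. The set thus lies in a finite product of finite sets. -/
theorem finite_of_countable_of_definable (hL : IsPolyBoundedOMinimal L) {α : Type*} [Finite α]
    {S : Set (α → ℝ)} (hS : (univ : Set ℝ).Definable L S) (hc : S.Countable) : S.Finite := by
  have h : ∀ i : α, ((fun x : α → ℝ => x i) '' S).Finite := fun i =>
    finite_of_definable₁ hL (definable₁_image_apply hS i) fun a b hab hsub =>
      not_countable_Icc hab ((hc.image _).mono hsub)
  exact (Set.Finite.pi h).subset fun x hx i _ => mem_image_of_mem _ hx

end DefinableSets

/-! ### Baire category. -/

section Baire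

theorem IsSigmaCompact.inter_isClosed {α : Type*} [TopologicalSpace α] {A Z : Set α}
    (hA : IsSigmaCompact A) (hZ : IsClosed Z) : IsSigmaCompact (A ∩ Z) := by
  obtain ⟨K, hK, rfl⟩ := hA
  exact ⟨fun k => K k ∩ Z, fun k => (hK k).inter_right hZ, (iUnion_inter _ _).symm⟩

/-- A form of the Baire category theorem inside an open set. -/
theorem exists_mem_forall_of_isOpen {α ι : Type*} [TopologicalSpace α] [BaireSpace α] [Countable ι]
    {W : Set α} (hW : IsOpen W) (hne : W.Nonempty) {O : ι → Set α} (hO : ∀ i, IsOpen (O i))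
    (hd : ∀ i, ∀ V ⊆ W, IsOpen V → V.Nonempty → (V ∩ O i).Nonempty) :
    ∃ u ∈ W, ∀ i, u ∈ O i := by
  -- Adding the exterior of `W` makes sets that are dense only in `W` dense in the whole space.
  have hdense : Dense (⋂ i, (O i ∪ (closure W)ᶜ)) := by
    refine dense_iInter_of_isOpen (fun i => (hO i).union isClosed_closure.isOpen_compl) fun i => ?_
    rw [dense_iff_inter_open]
    intro V hV hVne
    by_cases h : (V ∩ W).Nonempty
    · obtain ⟨x, hx, hxO⟩ := hd i (V ∩ W) inter_subset_right (hV.inter hW) h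
      exact ⟨x, hx.1, Or.inl hxO⟩
    · obtain ⟨x, hx⟩ := hVne
      refine ⟨x, hx, Or.inr fun hxc => h ?_⟩
      exact mem_closure_iff.1 hxc V hV hx
  obtain ⟨u, huW, hu⟩ := hdense.inter_open_nonempty W hW hne
  refine ⟨u, huW, fun i => ?_⟩
  rcases mem_iInter.1 hu i with h | h
  · exact h
  · exact absurd (subset_closure huW) h

theorem exists_rat_Icc_subset {V : Set ℝ} (hV : IsOpen V) (hne : V.Nonempty) :
    ∃ r s : ℚ, (r : ℝ) < s ∧ Icc (r : ℝ) s ⊆ V := by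
  obtain ⟨x, hx⟩ := hne
  obtain ⟨ε, hε, hb⟩ := Metric.isOpen_iff.1 hV x hx
  obtain ⟨r, hr1, hr2⟩ := exists_rat_btwn (show x - ε < x by linarith)
  obtain ⟨s, hs1, hs2⟩ := exists_rat_btwn (show x < x + ε by linarith)
  refine ⟨r, s, hr2.trans hs1, fun y hy => hb ?_⟩
  rw [Metric.mem_ball, Real.dist_eq, abs_lt]
  constructor <;> linarith [hy.1, hy.2]

end Baire

/-! ### Definable σ-compact sets that are somewhere dense have interior. -/

section DefinableInterior

variable {L : FirstOrder.Language.{u, v}} [L.Structure ℝ]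

theorem continuous_snoc_left {n : ℕ} (t : ℝ) :
    Continuous fun u : Fin n → ℝ => (Fin.snoc u t : Fin (n + 1) → ℝ) :=
  Continuous.finSnoc continuous_id continuous_const

theorem continuous_snoc_right {n : ℕ} (u : Fin n → ℝ) :
    Continuous fun t : ℝ => (Fin.snoc u t : Fin (n + 1) → ℝ) :=
  Continuous.finSnoc continuous_const continuous_id

theorem continuous_finInit {n : ℕ} :
    Continuous fun x : Fin (n + 1) → ℝ => (Fin.init x : Fin n → ℝ) :=
  continuous_pi fun i => continuous_apply (Fin.castSucc i)

/-- Local form of `H`, obtained by cutting `A` with a closed box inside `V`; the box preserves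
definability and σ-compactness. `H` is a hypothesis so that the lemma can serve inside the induction
that proves `H`. -/
theorem interior_inter_nonempty_of_subset_closure (hL : IsPolyBoundedOMinimal L) {n : ℕ}
    (H : ∀ A : Set (Fin n → ℝ), (univ : Set ℝ).Definable L A → IsSigmaCompact A →
      (interior (closure A)).Nonempty → (interior A).Nonempty)
    {A : Set (Fin n → ℝ)} (hA : (univ : Set ℝ).Definable L A) (hs : IsSigmaCompact A)
    {V : Set (Fin n → ℝ)} (hV : IsOpen V) (hne : V.Nonempty) (hVA : V ⊆ closure A) :
    (V ∩ interior A).Nonempty := by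
  obtain ⟨x, hx⟩ := hne
  obtain ⟨ε, hε, hb⟩ := Metric.nhds_basis_closedBall.mem_iff.1 (hV.mem_nhds hx)
  have hbox : Metric.closedBall x ε = Icc (fun i => x i - ε) (fun i => x i + ε) :=
    by rw [closedBall_pi x hε.le, ← pi_univ_Icc]; simp [Real.closedBall_eq_Icc]
  obtain ⟨y, hy⟩ := H (A ∩ Metric.closedBall x ε)
    (hA.inter (hbox ▸ definable_Icc hL _ _)) (hs.inter_isClosed Metric.isClosed_closedBall) (by
      refine ⟨x, interior_maximal (s := closure _) (t := Metric.ball x ε) ?_ Metric.isOpen_ball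
        (Metric.mem_ball_self hε)⟩
      intro z hz
      refine mem_closure_iff.2 fun o ho hzo => ?_
      obtain ⟨w, hw, hwA⟩ := mem_closure_iff.1 (hVA (hb (Metric.ball_subset_closedBall hz)))
        (o ∩ Metric.ball x ε) (ho.inter Metric.isOpen_ball) ⟨hzo, hz⟩
      exact ⟨w, hw.1, hwA, Metric.ball_subset_closedBall hw.2⟩)
  rw [interior_inter] at hy
  exact ⟨y, hb (interior_subset hy.2), hy.1⟩

theorem not_Icc_subset_of_isCompact {n : ℕ} {K : ℕ → Set (Fin (n + 1) → ℝ)}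
    (hK : ∀ k, IsCompact (K k)) {u : Fin n → ℝ}
    (hu : ∀ (k : ℕ) (r s : ℚ), (r : ℝ) < s →
      ¬ ∀ t ∈ Icc (r : ℝ) s, (Fin.snoc u t : Fin (n + 1) → ℝ) ∈ K k)
    (a b : ℝ) (hab : a < b) :
    ¬ Icc a b ⊆ {t | (Fin.snoc u t : Fin (n + 1) → ℝ) ∈ ⋃ k, K k} := by
  intro hsub
  obtain ⟨t, ht, htK⟩ := exists_mem_forall_of_isOpen (W := Ioo a b) isOpen_Ioo
    (nonempty_Ioo.2 hab) (O := fun k => {t | (Fin.snoc u t : Fin (n + 1) → ℝ) ∈ K k}ᶜ)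
    (fun k => ((hK k).isClosed.preimage (continuous_snoc_right u)).isOpen_compl)
    (fun k V _ hV hne => by
      by_contra hemp
      obtain ⟨r, s, hrs, hIcc⟩ := exists_rat_Icc_subset hV hne
      refine hu k r s hrs fun t ht => ?_
      by_contra htK
      exact hemp ⟨t, hIcc ht, htK⟩)
  obtain ⟨k, hk⟩ := mem_iUnion.1 (hsub (Ioo_subset_Icc_self ht))
  exact htK k hk

/-- Suppose `A` is dense in a box $W\times I$ but has no interior. For generic $u\in W$ the fibre
over $u$ contains no interval, hence is finite by o-minimality. But over a generic $u$ the fibre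
also meets every rational interval in $I$, since by induction the projections of the corresponding
slices have dense interior in $W$. These contradict each other. -/
theorem interior_nonempty_of_interior_closure (hL : IsPolyBoundedOMinimal L) (n : ℕ) :
    ∀ A : Set (Fin n → ℝ), (univ : Set ℝ).Definable L A → IsSigmaCompact A →
      (interior (closure A)).Nonempty → (interior A).Nonempty := by
  induction n with
  | zero =>
    rintro A - - hne
    obtain ⟨x, hx⟩ := closure_nonempty_iff.1 (hne.mono interior_subset)
    have : A = univ := eq_univ_of_forall fun y => Subsingleton.elim x y ▸ hx
    simp [this]
  | succ n ih =>
    rintro A hA hs ⟨x₀, hx₀⟩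
    by_contra hint
    rw [not_nonempty_iff_eq_empty] at hint
    obtain ⟨ε, hε, hb⟩ := Metric.isOpen_iff.1 isOpen_interior x₀ hx₀
    set W := Metric.ball (Fin.init x₀ : Fin n → ℝ) ε with hW
    set I := Metric.ball (x₀ (Fin.last n)) ε with hI
    have hWI : ∀ u ∈ W, ∀ t ∈ I, (Fin.snoc u t : Fin (n + 1) → ℝ) ∈ closure A := by
      intro u hu t ht
      refine interior_subset (hb ?_)
      rw [Metric.mem_ball, dist_pi_lt_iff hε]
      intro i
      refine Fin.lastCases ?_ (fun i => ?_) i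
      · simpa [hI] using ht
      · simpa [Fin.init] using (dist_pi_lt_iff hε).1 hu i
    let T : ℝ → ℝ → Set (Fin n → ℝ) := fun r s =>
      (fun x : Fin (n + 1) → ℝ => x ∘ Fin.castSucc) '' (A ∩ {x | x (Fin.last n) ∈ Icc r s})
    have hTdef : ∀ r s, (univ : Set ℝ).Definable L (T r s) := fun r s =>
      (hA.inter (definable_setOf_mem_Icc hL _ r s)).image_comp Fin.castSucc
    have hTs : ∀ r s, IsSigmaCompact (T r s) := fun r s =>
      (hs.inter_isClosed (isClosed_Icc.preimage (continuous_apply (Fin.last n)))).image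
        (continuous_finInit (n := n))
    have hTd : ∀ r s, r < s → Icc r s ⊆ I → W ⊆ closure (T r s) := by
      intro r s hrs hsub u hu
      refine mem_closure_iff.2 fun o ho huo => ?_
      have hmid : (r + s) / 2 ∈ Ioo r s := ⟨by linarith, by linarith⟩
      obtain ⟨x, ⟨hx1, hx2⟩, hxA⟩ := mem_closure_iff.1
        (hWI u hu _ (hsub (Ioo_subset_Icc_self hmid)))
        ((fun x : Fin (n + 1) → ℝ => (Fin.init x : Fin n → ℝ)) ⁻¹' o ∩
          {x | x (Fin.last n) ∈ Ioo r s})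
        ((ho.preimage continuous_finInit).inter
          (isOpen_Ioo.preimage (continuous_apply (Fin.last n)))) (by simpa using ⟨huo, hmid⟩)
      exact ⟨_, hx1, x, ⟨hxA, Ioo_subset_Icc_self hx2⟩, rfl⟩
    obtain ⟨K, hK, hKA⟩ := id hs
    let J := {p : ℚ × ℚ // (p.1 : ℝ) < p.2}
    -- The generic conditions on `u`: `none` asks that the fibre over `u` and its neighbours meet
    -- $[r,s]$, when $[r,s]\subseteq I$; `some k` asks that the segment over `u` is not contained in
    -- the compact piece `K k`.
    let O : J × Option ℕ → Set (Fin n → ℝ) := fun i => match i with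
      | (p, none) => interior (T p.1.1 p.1.2) ∪ {_u | ¬ Icc (p.1.1 : ℝ) p.1.2 ⊆ I}
      | (p, some k) => (⋂ t ∈ Icc (p.1.1 : ℝ) p.1.2,
          {u | (Fin.snoc u t : Fin (n + 1) → ℝ) ∈ K k})ᶜ
    have hO : ∀ i, IsOpen (O i) := by
      rintro ⟨p, _ | k⟩
      · exact isOpen_interior.union isOpen_const
      · exact (isClosed_biInter fun t _ =>
          (hK k).isClosed.preimage (continuous_snoc_left t)).isOpen_compl
    obtain ⟨u, huW, hu⟩ := exists_mem_forall_of_isOpen (W := W) Metric.isOpen_ball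
      ⟨_, Metric.mem_ball_self hε⟩ hO (by
      rintro ⟨p, _ | k⟩ V hVW hV hVne
      · by_cases hp : Icc (p.1.1 : ℝ) p.1.2 ⊆ I
        · obtain ⟨y, hy1, hy2⟩ := interior_inter_nonempty_of_subset_closure hL ih (hTdef _ _)
            (hTs _ _) hV hVne (hVW.trans (hTd _ _ p.2 hp))
          exact ⟨y, hy1, Or.inl hy2⟩
        · obtain ⟨y, hy⟩ := hVne
          exact ⟨y, hy, Or.inr hp⟩
      · by_contra hemp
        have hsub : (fun x : Fin (n + 1) → ℝ => (Fin.init x : Fin n → ℝ)) ⁻¹' V ∩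
            {x | x (Fin.last n) ∈ Ioo (p.1.1 : ℝ) p.1.2} ⊆ A := by
          rintro x ⟨hx1, hx2⟩
          have : (Fin.init x : Fin n → ℝ) ∈ ⋂ t ∈ Icc (p.1.1 : ℝ) p.1.2,
              {u | (Fin.snoc u t : Fin (n + 1) → ℝ) ∈ K k} := by
            by_contra hc
            exact hemp ⟨_, hx1, hc⟩
          have := mem_iInter₂.1 this _ (Ioo_subset_Icc_self hx2)
          rw [← hKA]
          exact mem_iUnion.2 ⟨k, by simpa using this⟩
        have hsub' := interior_maximal hsub ((hV.preimage continuous_finInit).inter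
          (isOpen_Ioo.preimage (continuous_apply (Fin.last n))))
        rw [hint] at hsub'
        obtain ⟨y, hy⟩ := hVne
        obtain ⟨t, ht⟩ := nonempty_Ioo.2 p.2
        exact hsub' (a := Fin.snoc y t) (by simpa using ⟨hy, ht⟩))
    have hfin : {t | (Fin.snoc u t : Fin (n + 1) → ℝ) ∈ A}.Finite := by
      refine finite_of_definable₁ hL ?_ ?_
      · convert definable₁_image_apply (definable_fiber hA Fin.castSucc u) (Fin.last n) using 1
        ext t
        constructor
        · intro ht
          exact ⟨_, ⟨ht, by simp⟩, by simp⟩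
        · rintro ⟨x, ⟨hxA, hx⟩, rfl⟩
          have : (Fin.init x : Fin n → ℝ) = u := funext hx
          change (Fin.snoc u (x (Fin.last n)) : Fin (n + 1) → ℝ) ∈ A
          rw [← this, Fin.snoc_init_self]
          exact hxA
      · rw [← hKA]
        refine not_Icc_subset_of_isCompact hK fun k r s hrs hall => ?_
        exact hu (⟨(r, s), hrs⟩, some k) (mem_iInter₂.2 hall)
    have hne : (I \ {t | (Fin.snoc u t : Fin (n + 1) → ℝ) ∈ A}).Nonempty := by
      refine Set.Infinite.nonempty (Set.Infinite.sdiff ?_ hfin)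
      rw [hI, Real.ball_eq_Ioo]
      exact Ioo_infinite (by linarith)
    obtain ⟨r, s, hrs, hsub⟩ := exists_rat_Icc_subset
      (Metric.isOpen_ball.sdiff hfin.isClosed) hne
    rcases hu (⟨(r, s), hrs⟩, none) with h | h
    · obtain ⟨x, ⟨hxA, hx⟩, hxu⟩ := interior_subset h
      refine (hsub hx).2 ?_
      change (Fin.snoc u (x (Fin.last n)) : Fin (n + 1) → ℝ) ∈ A
      have : (Fin.init x : Fin n → ℝ) = u := hxu
      rw [← this, Fin.snoc_init_self]
      exact hxA
    · exact h (hsub.trans sdiff_subset)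

end DefinableInterior

/-! ### Cells as graphs over open sets of coordinates. -/

section Cells

variable {L : FirstOrder.Language.{u, v}} [L.Structure ℝ]

/-- `ψ` parametrizes `C` over the open set `O`, and the coordinates selected by `ι` invert it. -/
structure IsCoordParam {n d : ℕ} (C : Set (Fin n → ℝ)) (ι : Fin d → Fin n) (O : Set (Fin d → ℝ))
    (ψ : (Fin d → ℝ) → Fin n → ℝ) : Prop where
  isOpen : IsOpen O
  contDiffOn : ContDiffOn ℝ 2 ψ O
  image_eq : ψ '' O = C
  comp_eq : ∀ s ∈ O, ψ s ∘ ι = s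

theorem contDiff_finInit {n : ℕ} :
    ContDiff ℝ 2 fun x : Fin (n + 1) → ℝ => (Fin.init x : Fin n → ℝ) :=
  contDiff_pi.2 fun i => contDiff_apply ℝ ℝ (Fin.castSucc i)

theorem ContDiffOn.finSnoc {n : ℕ} {E : Type*} [NormedAddCommGroup E] [NormedSpace ℝ E]
    {f : E → Fin n → ℝ} {g : E → ℝ} {s : Set E} (hf : ContDiffOn ℝ 2 f s)
    (hg : ContDiffOn ℝ 2 g s) :
    ContDiffOn ℝ 2 (fun x => (Fin.snoc (f x) (g x) : Fin (n + 1) → ℝ)) s := by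
  refine contDiffOn_pi.2 fun i => ?_
  refine Fin.lastCases ?_ (fun i => ?_) i
  · simpa using hg
  · simpa using contDiffOn_pi.1 hf i

namespace IsCoordParam

variable {n d : ℕ} {C : Set (Fin n → ℝ)} {ι : Fin d → Fin n} {O : Set (Fin d → ℝ)}
  {ψ : (Fin d → ℝ) → Fin n → ℝ}

theorem mapsTo (h : IsCoordParam C ι O ψ) : MapsTo ψ O C := h.image_eq ▸ mapsTo_image ψ O

theorem graph (h : IsCoordParam C ι O ψ) {f : (Fin n → ℝ) → ℝ} (hf : ContDiffOn ℝ 2 f C) :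
    IsCoordParam {x : Fin (n + 1) → ℝ | Fin.init x ∈ C ∧ x (Fin.last n) = f (Fin.init x)}
      (fun i => Fin.castSucc (ι i)) O (fun s => Fin.snoc (ψ s) (f (ψ s))) where
  isOpen := h.isOpen
  contDiffOn := h.contDiffOn.finSnoc (hf.comp h.contDiffOn h.mapsTo)
  image_eq := by
    ext x
    constructor
    · rintro ⟨s, hs, rfl⟩
      exact ⟨by simpa using h.mapsTo hs, by simp⟩
    · rintro ⟨hx, hxl⟩
      obtain ⟨s, hs, hsx⟩ := h.image_eq.symm ▸ hx
      refine ⟨s, hs, ?_⟩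
      simp only [hsx, ← hxl, Fin.snoc_init_self]
  comp_eq s hs := by
    ext i
    simpa using congrFun (h.comp_eq s hs) i

/-- `Z` carries the inequalities on the last coordinate, so that all kinds of bands and the cylinder
are treated together; only openness of the parameter domain differs. -/
theorem band (h : IsCoordParam C ι O ψ) {Z : Set (Fin (n + 1) → ℝ)}
    (hO : IsOpen {s : Fin (d + 1) → ℝ | Fin.init s ∈ O ∧
      (Fin.snoc (ψ (Fin.init s)) (s (Fin.last d)) : Fin (n + 1) → ℝ) ∈ Z}) :
    IsCoordParam {x : Fin (n + 1) → ℝ | Fin.init x ∈ C ∧ x ∈ Z}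
      (Fin.snoc (α := fun _ => Fin (n + 1)) (fun i => Fin.castSucc (ι i)) (Fin.last n))
      {s : Fin (d + 1) → ℝ | Fin.init s ∈ O ∧
        (Fin.snoc (ψ (Fin.init s)) (s (Fin.last d)) : Fin (n + 1) → ℝ) ∈ Z}
      (fun s => Fin.snoc (ψ (Fin.init s)) (s (Fin.last d))) where
  isOpen := hO
  contDiffOn := ((h.contDiffOn.comp contDiff_finInit.contDiffOn fun _ hs => hs).finSnoc
    (contDiff_apply ℝ ℝ (Fin.last d)).contDiffOn).mono fun _ hs => hs.1
  image_eq := by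
    ext x
    constructor
    · rintro ⟨s, hs, rfl⟩
      exact ⟨by simpa using h.mapsTo hs.1, hs.2⟩
    · rintro ⟨hx, hxZ⟩
      obtain ⟨s, hs, hsx⟩ := h.image_eq.symm ▸ hx
      refine ⟨Fin.snoc s (x (Fin.last n)), ?_, ?_⟩
      · simpa [hsx, hs] using hxZ
      · simp [hsx]
  comp_eq s hs := by
    ext i
    refine Fin.lastCases ?_ (fun i => ?_) i
    · simp
    · simpa [Fin.init] using congrFun (h.comp_eq _ hs.1) i

end IsCoordParam

theorem IsC2CellCoord.exists_isCoordParam {n d : ℕ} {C : Set (Fin n → ℝ)}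
    (h : IsC2CellCoord L n d C) :
    ∃ (ι : Fin d → Fin n) (O : Set (Fin d → ℝ)) (ψ : (Fin d → ℝ) → Fin n → ℝ),
      IsCoordParam C ι O ψ := by
  have key : ∀ {n d : ℕ} {C : Set (Fin n → ℝ)} {ι : Fin d → Fin n} {O : Set (Fin d → ℝ)}
      {ψ : (Fin d → ℝ) → Fin n → ℝ} (_ : IsCoordParam C ι O ψ) {f : (Fin n → ℝ) → ℝ}
      (_ : ContDiffOn ℝ 2 f C), ContinuousOn (fun s : Fin (d + 1) → ℝ => f (ψ (Fin.init s)))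
        {s | Fin.init s ∈ O} := by
    intro n d C ι O ψ hp f hf
    exact (hf.continuousOn.comp hp.contDiffOn.continuousOn hp.mapsTo).comp
      continuous_finInit.continuousOn fun _ hs => hs
  have hlast : ∀ {d : ℕ} {S : Set (Fin (d + 1) → ℝ)},
      ContinuousOn (fun s : Fin (d + 1) → ℝ => s (Fin.last d)) S := fun {d S} =>
    (continuous_apply (Fin.last d)).continuousOn
  have hinit : ∀ {d : ℕ} {O : Set (Fin d → ℝ)}, IsOpen O →
      IsOpen {s : Fin (d + 1) → ℝ | Fin.init s ∈ O} := fun hO => hO.preimage continuous_finInit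
  induction h with
  | point =>
    exact ⟨id, univ, id, isOpen_univ, contDiffOn_id, by simp, fun _ _ => rfl⟩
  | graph f _ hf _ ih =>
    obtain ⟨ι, O, ψ, hp⟩ := ih
    exact ⟨_, _, _, hp.graph hf⟩
  | @band n d C f g _ hf _ hg _ _ ih =>
    obtain ⟨ι, O, ψ, hp⟩ := ih
    refine ⟨_, _, _, hp.band (Z := {x | f (Fin.init x) < x (Fin.last n) ∧
      x (Fin.last n) < g (Fin.init x)}) ?_⟩
    have h1 := (key hp hf).prodMk hlast
    have h2 := hlast.prodMk (key hp hg)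
    have o1 := h1.isOpen_inter_preimage (hinit hp.isOpen) isOpen_lt_prod
    have o2 := h2.isOpen_inter_preimage (hinit hp.isOpen) isOpen_lt_prod
    convert o1.inter o2 using 1
    ext s
    simp
    tauto
  | @bandAbove n d C f _ hf _ ih =>
    obtain ⟨ι, O, ψ, hp⟩ := ih
    refine ⟨_, _, _, hp.band (Z := {x | f (Fin.init x) < x (Fin.last n)}) ?_⟩
    have h1 := (key hp hf).prodMk hlast
    convert h1.isOpen_inter_preimage (hinit hp.isOpen) isOpen_lt_prod using 1
    ext s
    simp
  | @bandBelow n d C g _ hg _ ih =>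
    obtain ⟨ι, O, ψ, hp⟩ := ih
    refine ⟨_, _, _, hp.band (Z := {x | x (Fin.last n) < g (Fin.init x)}) ?_⟩
    have h2 := hlast.prodMk (key hp hg)
    convert h2.isOpen_inter_preimage (hinit hp.isOpen) isOpen_lt_prod using 1
    ext s
    simp
  | @cylinder n d C _ ih =>
    obtain ⟨ι, O, ψ, hp⟩ := ih
    have := hp.band (Z := univ) (by simpa using hinit hp.isOpen)
    exact ⟨_, _, _, by simpa using this⟩

theorem IsC2CellCoord.le {n d : ℕ} {C : Set (Fin n → ℝ)} (h : IsC2CellCoord L n d C) : d ≤ n := by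
  induction h <;> omega

/-- The value of `f` is introduced as an additional coordinate, compared with the last one, and
projected away. -/
theorem definable_above (hL : IsPolyBoundedOMinimal L) {n : ℕ} {C : Set (Fin n → ℝ)}
    {f : (Fin n → ℝ) → ℝ} (hf : DefinableFunOn L f C) :
    (univ : Set ℝ).Definable L
      {x : Fin (n + 1) → ℝ | Fin.init x ∈ C ∧ f (Fin.init x) < x (Fin.last n)} := by
  have h1 := Set.Definable.preimage_comp
    (Fin.snoc (α := fun _ => Fin (n + 2)) (fun i : Fin n => (Fin.castSucc (Fin.castSucc i)))
      (Fin.last (n + 1))) hf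
  have h := (h1.inter (definable_setOf_lt hL (Fin.last (n + 1))
    (Fin.castSucc (Fin.last n)))).image_comp Fin.castSucc
  convert h using 1
  ext x
  simp only [mem_image, mem_inter_iff, mem_preimage, mem_ofPred_eq, Function.comp_apply,
    Fin.snoc_last]
  constructor
  · rintro ⟨hx, hlt⟩
    refine ⟨Fin.snoc x (f (Fin.init x)), ⟨⟨?_, ?_⟩, ?_⟩, ?_⟩
    · convert hx using 1
      ext i
      simp [Fin.init]
    · simp only [Fin.snoc_last]
      congr 1
      ext i
      simp [Fin.init]
    · simpa using hlt
    · ext i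
      simp
  · rintro ⟨y, ⟨⟨hy1, hy2⟩, hy3⟩, rfl⟩
    have e : (Fin.init (y ∘ Fin.castSucc : Fin (n + 1) → ℝ) : Fin n → ℝ) =
        Fin.init (y ∘ (Fin.snoc (α := fun _ => Fin (n + 2))
          (fun i : Fin n => (Fin.castSucc (Fin.castSucc i))) (Fin.last (n + 1)))) := by
      ext i
      simp [Fin.init]
    rw [e]
    exact ⟨hy1, hy2 ▸ hy3⟩

theorem definable_below (hL : IsPolyBoundedOMinimal L) {n : ℕ} {C : Set (Fin n → ℝ)}
    (hC : (univ : Set ℝ).Definable L C)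
    {f : (Fin n → ℝ) → ℝ} (hf : DefinableFunOn L f C) :
    (univ : Set ℝ).Definable L
      {x : Fin (n + 1) → ℝ | Fin.init x ∈ C ∧ x (Fin.last n) < f (Fin.init x)} := by
  have h0 : (univ : Set ℝ).Definable L {x : Fin (n + 1) → ℝ | Fin.init x ∈ C} :=
    hC.preimage_comp Fin.castSucc
  convert (h0.sdiff (definable_above hL hf)).sdiff hf using 1
  ext x
  simp only [mem_ofPred_eq, mem_sdiff, not_and, not_lt]
  constructor
  · rintro ⟨h1, h2⟩
    exact ⟨⟨h1, fun _ => h2.le⟩, fun _ => h2.ne⟩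
  · rintro ⟨⟨h1, h2⟩, h3⟩
    exact ⟨h1, lt_of_le_of_ne (h2 h1) (h3 h1)⟩

theorem IsC2CellCoord.definable (hL : IsPolyBoundedOMinimal L) {n d : ℕ} {C : Set (Fin n → ℝ)}
    (h : IsC2CellCoord L n d C) : (univ : Set ℝ).Definable L C := by
  induction h with
  | point => exact Set.definable_univ
  | graph f _ _ hf' _ => exact hf'
  | band f g _ _ hf' _ hg' _ ih =>
    convert (definable_above hL hf').inter (definable_below hL ih hg') using 1
    ext x
    simp only [mem_ofPred_eq, mem_inter_iff]
    tauto
  | bandAbove f _ _ hf' _ => exact definable_above hL hf'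
  | bandBelow g _ _ hg' ih => exact definable_below hL ih hg'
  | cylinder _ ih => exact ih.preimage_comp Fin.castSucc

theorem IsOpen.isSigmaCompact_inter_preimage {E F : Type*} [PseudoMetricSpace E]
    [SigmaCompactSpace E] [TopologicalSpace F] {O : Set E} (hO : IsOpen O) {g : E → F}
    (hg : ContinuousOn g O) {t : Set F} (ht : IsClosed t) : IsSigmaCompact (O ∩ g ⁻¹' t) := by
  obtain ⟨F, hF, hFO, hU, -⟩ := hO.exists_iUnion_isClosed
  rw [← hU, iUnion_inter]
  exact isSigmaCompact_iUnion _ fun k => isSigmaCompact_univ.of_isClosed_subset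
    ((hg.mono (hFO k)).preimage_isClosed_of_isClosed (hF k) ht) (subset_univ _)

theorem IsCoordParam.isSigmaCompact {n d : ℕ} {C : Set (Fin n → ℝ)} {ι : Fin d → Fin n}
    {O : Set (Fin d → ℝ)} {ψ : (Fin d → ℝ) → Fin n → ℝ} (h : IsCoordParam C ι O ψ) :
    IsSigmaCompact C := by
  rw [← h.image_eq]
  have h' := h.isOpen.isSigmaCompact_inter_preimage continuousOn_id isClosed_univ
  rw [preimage_univ, inter_univ] at h'
  exact h'.image_of_continuousOn h.contDiffOn.continuousOn

end Cells

/-! ### The frontier inequality for cells. -/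

section FrontierInequality

open MeasureTheory

variable {L : FirstOrder.Language.{u, v}} [L.Structure ℝ]

/-- Off a `σ`-compact null set, the fibres of a coordinate projection to a space of at least the
dimension of a cell meet the cell in countable sets. -/
theorem IsCoordParam.exists_null_countable_fiber {n d e : ℕ} {C : Set (Fin n → ℝ)}
    {ι : Fin d → Fin n} {O : Set (Fin d → ℝ)} {ψ : (Fin d → ℝ) → Fin n → ℝ}
    (h : IsCoordParam C ι O ψ) (hde : d ≤ e) (q : Fin e → Fin n) :
    ∃ N : Set (Fin e → ℝ), IsSigmaCompact N ∧ volume N = 0 ∧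
      ∀ u ∉ N, (C ∩ {x | ∀ j, x (q j) = u j}).Countable := by
  -- Dummy parameters pad the domain from dimension `d` to `e`, so that `G` maps $\mathbb R^e$ to
  -- itself and its critical values are null by the determinant form of Sard's theorem.
  let pr : (Fin e → ℝ) → Fin d → ℝ := fun s i => s (Fin.castLE hde i)
  have hpr : ContDiff ℝ 2 pr := contDiff_pi.2 fun i => contDiff_apply ℝ ℝ (Fin.castLE hde i)
  have hprs : Function.Surjective pr := by
    intro s
    refine ⟨fun i => if hi : (i : ℕ) < d then s ⟨i, hi⟩ else 0, ?_⟩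
    ext i
    simp [pr]
  let O' := pr ⁻¹' O
  have hO' : IsOpen O' := h.isOpen.preimage hpr.continuous
  let G : (Fin e → ℝ) → Fin e → ℝ := fun s j => ψ (pr s) (q j)
  have hψ : ContDiffOn ℝ 2 (fun s => ψ (pr s)) O' :=
    h.contDiffOn.comp hpr.contDiffOn fun _ hs => hs
  have hG : ContDiffOn ℝ 2 G O' := contDiffOn_pi.2 fun j => contDiffOn_pi.1 hψ (q j)
  have hG' : ∀ s ∈ O', HasFDerivAt G (fderiv ℝ G s) s := fun s hs =>
    ((hG.contDiffAt (hO'.mem_nhds hs)).differentiableAt (by norm_num)).hasFDerivAt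
  have hdet : ContinuousOn (fun s => (fderiv ℝ G s).det) O' :=
    ContinuousLinearMap.continuous_det.comp_continuousOn
      (hG.continuousOn_fderiv_of_isOpen hO' (by norm_num))
  have hcrit := hO'.isSigmaCompact_inter_preimage hdet (isClosed_singleton (x := 0))
  refine ⟨_, hcrit.image_of_continuousOn (hG.continuousOn.mono inter_subset_left),
    addHaar_image_eq_zero_of_det_fderivWithin_eq_zero volume
      (fun s hs => (hG' s hs.1).hasFDerivWithinAt) (fun s hs => hs.2), fun u hu => ?_⟩
  -- At a noncritical point the derivative is invertible, so nearby parameters have other values: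
  -- the fibre is discrete, hence countable by the Lindelöf property.
  have hS : {s | s ∈ O' ∧ G s = u}.Countable := by
    refine (HereditarilyLindelofSpace.isLindelof _).countable
      (discreteTopology_subtype_iff.2 fun s hs => ?_)
    have hne : (fderiv ℝ G s).det ≠ 0 := fun h0 => hu ⟨s, ⟨hs.1, h0⟩, hs.2⟩
    have hev := (hG' s hs.1).eventually_ne (c := u)
      ⟨_, ((fderiv ℝ G s).toContinuousLinearEquivOfDetNeZero hne).antilipschitz⟩
    rw [Filter.inf_principal_eq_bot]
    filter_upwards [hev] with z hz hzS using hz hzS.2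
  refine (hS.image fun s => ψ (pr s)).mono ?_
  rintro x ⟨hx, hxu⟩
  obtain ⟨s', hs', rfl⟩ := h.image_eq.symm ▸ hx
  obtain ⟨s, rfl⟩ := hprs s'
  exact ⟨s, ⟨hs', funext hxu⟩, rfl⟩

theorem exists_rat_Icc_mem_nhds {n : ℕ} {x : Fin n → ℝ} {V : Set (Fin n → ℝ)} (hV : V ∈ nhds x) :
    ∃ a b : Fin n → ℚ, Icc (fun i => (a i : ℝ)) (fun i => (b i : ℝ)) ⊆ V ∧
      x ∈ interior (Icc (fun i => (a i : ℝ)) (fun i => (b i : ℝ))) := by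
  obtain ⟨ε, hε, hb⟩ := Metric.nhds_basis_closedBall.mem_iff.1 hV
  choose a ha1 ha2 using fun i => exists_rat_btwn (show x i - ε < x i by linarith)
  choose b hb1 hb2 using fun i => exists_rat_btwn (show x i < x i + ε by linarith)
  refine ⟨a, b, fun y hy => hb ?_, ?_⟩
  · rw [Metric.mem_closedBall, dist_pi_le_iff hε.le]
    intro i
    rw [Real.dist_eq, abs_le]
    have h1 := hy.1 i
    have h2 := hy.2 i
    have h3 := ha1 i
    have h4 := hb2 i
    dsimp only at h1 h2
    constructor <;> linarith
  · rw [← pi_univ_Icc, interior_pi_set finite_univ]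
    intro i _
    change x i ∈ interior (Icc (a i : ℝ) (b i))
    rw [interior_Icc]
    exact ⟨ha2 i, hb1 i⟩

/-- A nonempty cell `D` is not contained in the frontier of a disjoint cell `C` of dimension at
most that of `D`. -/
theorem IsC2CellCoord.not_subset_closure (hL : IsPolyBoundedOMinimal L) {n d e : ℕ}
    {C D : Set (Fin n → ℝ)} (hC : IsC2CellCoord L n d C) (hD : IsC2CellCoord L n e D)
    (hde : d ≤ e) (hdisj : Disjoint C D) (hne : D.Nonempty) : ¬ D ⊆ closure C := by
  intro hsub
  obtain ⟨ιC, OC, ψC, hpC⟩ := hC.exists_isCoordParam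
  obtain ⟨q, O, ψ, hpD⟩ := hD.exists_isCoordParam
  have hCdef := hC.definable hL
  obtain ⟨N, hN, hN0, hNc⟩ := hpC.exists_null_countable_fiber hde q
  obtain ⟨K, hK, hKN⟩ := hN
  let R : (Fin n → ℚ) × (Fin n → ℚ) → Set (Fin n → ℝ) := fun p =>
    Icc (fun i => (p.1 i : ℝ)) (fun i => (p.2 i : ℝ))
  let A : (Fin n → ℚ) × (Fin n → ℚ) → Set (Fin e → ℝ) := fun p =>
    (fun x : Fin n → ℝ => x ∘ q) '' (C ∩ R p)
  let V : (Fin n → ℚ) × (Fin n → ℚ) → Set (Fin e → ℝ) := fun p => O ∩ ψ ⁻¹' interior (R p)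
  have hq : Continuous fun x : Fin n → ℝ => x ∘ q :=
    continuous_pi fun j => continuous_apply (q j)
  have hA : ∀ p, (univ : Set ℝ).Definable L (A p) := fun p =>
    (hCdef.inter (definable_Icc hL _ _)).image_comp q
  have hAs : ∀ p, IsSigmaCompact (A p) := fun p =>
    (hpC.isSigmaCompact.inter_isClosed isClosed_Icc).image hq
  have hV : ∀ p, IsOpen (V p) := fun p =>
    hpD.contDiffOn.continuousOn.isOpen_inter_preimage hpD.isOpen isOpen_interior
  have hVA : ∀ p, V p ⊆ closure (A p) := by
    rintro p u ⟨huO, hu⟩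
    refine mem_closure_iff.2 fun o ho huo => ?_
    obtain ⟨x, ⟨hxo, hxR⟩, hxC⟩ := mem_closure_iff.1 (hsub (hpD.mapsTo huO))
      ((fun x : Fin n → ℝ => x ∘ q) ⁻¹' o ∩ interior (R p))
      ((ho.preimage hq).inter isOpen_interior)
      ⟨by rw [mem_preimage, hpD.comp_eq u huO]; exact huo, hu⟩
    exact ⟨_, hxo, x, ⟨hxC, interior_subset hxR⟩, rfl⟩
  let M : ((Fin n → ℚ) × (Fin n → ℚ)) ⊕ ℕ → Set (Fin e → ℝ) :=
    Sum.elim (fun p => interior (A p) ∪ (closure (V p))ᶜ) (fun k => (K k)ᶜ)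
  -- For generic `u` the fibre of `C` over `u` is finite, so some rational box around `ψ u` misses
  -- it. The projection of `C` intersected with this box is dense near `u`, and genericity makes `u`
  -- belong to it: contradiction.
  obtain ⟨u, huO, hu⟩ := exists_mem_forall_of_isOpen (O := M) hpD.isOpen
    (by rw [← hpD.image_eq] at hne; exact hne.of_image) (by
      rintro (p | k)
      · exact isOpen_interior.union isClosed_closure.isOpen_compl
      · exact (hK k).isClosed.isOpen_compl) (by
      rintro (p | k) W - hW hWne
      · by_cases h : (W ∩ V p).Nonempty
        · obtain ⟨y, hy1, hy2⟩ := interior_inter_nonempty_of_subset_closure hL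
            (interior_nonempty_of_interior_closure hL e) (hA p) (hAs p) (hW.inter (hV p)) h
            (inter_subset_right.trans (hVA p))
          exact ⟨y, hy1.1, Or.inl hy2⟩
        · obtain ⟨y, hy⟩ := hWne
          exact ⟨y, hy, Or.inr fun hyc => h (mem_closure_iff.1 hyc W hW hy)⟩
      · by_contra hemp
        have hWK : W ⊆ N := fun y hy => by
          by_contra hyN
          exact hemp ⟨y, hy, fun hyK => hyN (hKN ▸ mem_iUnion.2 ⟨k, hyK⟩)⟩
        exact (hW.measure_pos volume hWne).ne' (measure_mono_null hWK hN0))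
  have huN : u ∉ N := fun huN => by
    obtain ⟨k, hk⟩ := mem_iUnion.1 (hKN.symm ▸ huN)
    exact hu (Sum.inr k) hk
  have hfin := finite_of_countable_of_definable hL (definable_fiber hCdef q u) (hNc u huN)
  obtain ⟨a, b, hab, hmem⟩ := exists_rat_Icc_mem_nhds
    (hfin.isClosed.isOpen_compl.mem_nhds
      (fun hc => hdisj.le_bot ⟨hc.1, hpD.mapsTo huO⟩ :
        ψ u ∈ (C ∩ {x | ∀ j, x (q j) = u j})ᶜ))
  rcases hu (Sum.inl (a, b)) with h | h
  · obtain ⟨x, ⟨hxC, hxR⟩, hxu⟩ := interior_subset h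
    exact hab hxR ⟨hxC, congrFun hxu⟩
  · exact h (subset_closure ⟨huO, hmem⟩)

end FrontierInequality

/-! ### Tangent spaces and dimension of cells. -/

section EuclideanCells

open Topology

/-- The derivative maps the tangent cone of `S` into that of the image, which near `x` is the single
point `0`. -/
theorem HasFDerivAt.eq_zero_of_mem_tangentConeAt {E F : Type*} [NormedAddCommGroup E]
    [NormedSpace ℝ E] [NormedAddCommGroup F] [NormedSpace ℝ F] {g : E → F} {g' : E →L[ℝ] F}
    {x : E} (hg : HasFDerivAt g g' x) {S : Set E} (hgx : g x = 0)
    (hS : ∀ᶠ y in 𝓝[S] x, g y = 0) {v : E} (hv : v ∈ tangentConeAt ℝ S x) : g' v = 0 := by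
  obtain ⟨W, hW, hWS⟩ := mem_nhdsWithin_iff_exists_mem_nhds_inter.1 hS
  rw [← tangentConeAt_inter_nhds hW, inter_comm] at hv
  have hv' := (hg.hasFDerivWithinAt (s := W ∩ S)).mapsTo_tangent_cone hv
  rw [hgx] at hv'
  have himg : g '' (W ∩ S) ⊆ {0} := by
    rintro _ ⟨y, hy, rfl⟩
    exact hWS hy
  refine tangentConeAt_subset_zero (𝕜 := ℝ) (x := 0) (fun hacc => ?_) (tangentConeAt_mono himg hv')
  obtain ⟨y, hy, hne⟩ := accPt_iff_nhds.1 hacc univ Filter.univ_mem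
  exact hne hy.2

variable {L : FirstOrder.Language.{u, v}} [L.Structure ℝ]

/-- `ψ` parametrizes `c` over the open set `O`, with the linear left inverse `ρ`. -/
structure IsLinParam {m d : ℕ} (c : Set (Euc m)) (O : Set (Fin d → ℝ)) (ψ : (Fin d → ℝ) → Euc m)
    (ρ : Euc m →L[ℝ] (Fin d → ℝ)) : Prop where
  isOpen : IsOpen O
  contDiffOn : ContDiffOn ℝ 2 ψ O
  image_eq : ψ '' O = c
  left_inv : ∀ s ∈ O, ρ (ψ s) = s

theorem IsC2Cell.exists_isLinParam {m d : ℕ} {c : Set (Euc m)} (h : IsC2Cell L d c) :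
    ∃ (O : Set (Fin d → ℝ)) (ψ : (Fin d → ℝ) → Euc m) (ρ : Euc m →L[ℝ] (Fin d → ℝ)),
      IsLinParam c O ψ ρ := by
  obtain ⟨ι, O, ψ, hp⟩ := IsC2CellCoord.exists_isCoordParam h
  refine ⟨O, fun s => (EuclideanSpace.equiv (Fin m) ℝ).symm (ψ s),
    ContinuousLinearMap.pi fun i => EuclideanSpace.proj (ι i), hp.isOpen, ?_, ?_, ?_⟩
  · exact (EuclideanSpace.equiv (Fin m) ℝ).symm.contDiff.comp_contDiffOn hp.contDiffOn
  · ext x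
    constructor
    · rintro ⟨s, hs, rfl⟩
      exact hp.mapsTo hs
    · intro hx
      have hx' : (EuclideanSpace.equiv (Fin m) ℝ x) ∈ {y : Fin m → ℝ | WithLp.toLp 2 y ∈ c} := hx
      obtain ⟨s, hs, hsx⟩ := hp.image_eq.symm ▸ hx'
      exact ⟨s, hs, by simp only [hsx]; simp⟩
  · intro s hs
    exact hp.comp_eq s hs

theorem IsC2Cell.le {m d : ℕ} {c : Set (Euc m)} (h : IsC2Cell L d c) : d ≤ m :=
  IsC2CellCoord.le h

theorem IsC2Cell.not_subset_closure (hL : IsPolyBoundedOMinimal L) {m d e : ℕ}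
    {c c' : Set (Euc m)} (hc : IsC2Cell L d c) (hc' : IsC2Cell L e c')
    (hde : d ≤ e) (hdisj : Disjoint c c') (hne : c'.Nonempty) : ¬ c' ⊆ closure c := by
  intro hsub
  let E := (EuclideanSpace.equiv (Fin m) ℝ).symm
  refine IsC2CellCoord.not_subset_closure hL hc hc' hde (hdisj.preimage E)
    (hne.preimage E.surjective) ?_
  change E ⁻¹' c' ⊆ closure (E ⁻¹' c)
  rw [← E.preimage_closure]
  exact preimage_mono hsub

namespace IsLinParam

variable {m d : ℕ} {c : Set (Euc m)} {O : Set (Fin d → ℝ)} {ψ : (Fin d → ℝ) → Euc m}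
  {ρ : Euc m →L[ℝ] (Fin d → ℝ)}

theorem mapsTo (h : IsLinParam c O ψ ρ) : MapsTo ψ O c := h.image_eq ▸ mapsTo_image ψ O

theorem hasFDerivAt (h : IsLinParam c O ψ ρ) {s : Fin d → ℝ} (hs : s ∈ O) :
    HasFDerivAt ψ (fderiv ℝ ψ s) s :=
  ((h.contDiffOn.contDiffAt (h.isOpen.mem_nhds hs)).differentiableAt (by norm_num)).hasFDerivAt

theorem map_mem (h : IsLinParam c O ψ ρ) {x : Euc m} (hx : x ∈ c) : ρ x ∈ O ∧ ψ (ρ x) = x := by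
  obtain ⟨s, hs, rfl⟩ := h.image_eq.symm ▸ hx
  rw [h.left_inv s hs]
  exact ⟨hs, rfl⟩

/-- On `c` the map $y\mapsto y-\psi(\rho y)$ vanishes, so a tangent vector $v$ satisfies
$v=D\psi(\rho v)$. The other inclusion pushes forward the full tangent cone of `O`. -/
theorem tangentConeAt_eq (h : IsLinParam c O ψ ρ) {x : Euc m} (hx : x ∈ c) :
    tangentConeAt ℝ c x = LinearMap.range (fderiv ℝ ψ (ρ x)).toLinearMap := by
  obtain ⟨hs, hsx⟩ := h.map_mem hx
  have hψ := h.hasFDerivAt hs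
  apply Subset.antisymm
  · intro v hv
    have hg : HasFDerivAt (fun y => y - ψ (ρ y))
        (ContinuousLinearMap.id ℝ (Euc m) - (fderiv ℝ ψ (ρ x)).comp ρ) x :=
      (hasFDerivAt_id x).sub (hψ.comp x ρ.hasFDerivAt)
    have h1 : v - fderiv ℝ ψ (ρ x) (ρ v) = 0 :=
      hg.eq_zero_of_mem_tangentConeAt (by rw [hsx, sub_self]) (by
        filter_upwards [self_mem_nhdsWithin] with y hy
        rw [(h.map_mem hy).2, sub_self]) hv
    exact ⟨ρ v, (sub_eq_zero.1 h1).symm⟩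
  · rintro _ ⟨w, rfl⟩
    have hm := (hψ.hasFDerivWithinAt (s := O)).mapsTo_tangent_cone
      (tangentConeAt_of_mem_nhds (𝕜 := ℝ) (h.isOpen.mem_nhds hs) ▸ mem_univ w)
    rw [h.image_eq, hsx] at hm
    exact hm

theorem fderiv_injective (h : IsLinParam c O ψ ρ) {s : Fin d → ℝ} (hs : s ∈ O) :
    Function.Injective (fderiv ℝ ψ s) := by
  have h1 : HasFDerivAt (fun t => ρ (ψ t)) (ρ.comp (fderiv ℝ ψ s)) s :=
    ρ.hasFDerivAt.comp s (h.hasFDerivAt hs)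
  have h2 : HasFDerivAt (fun t => ρ (ψ t)) (ContinuousLinearMap.id ℝ _) s :=
    (hasFDerivAt_id s).congr_of_eventuallyEq
      (Filter.eventuallyEq_of_mem (h.isOpen.mem_nhds hs) fun t ht => h.left_inv t ht)
  have h3 := h1.unique h2
  exact Function.LeftInverse.injective (g := ρ) fun w => congrArg (fun f => f w) h3

theorem finrank_span_tangentConeAt (h : IsLinParam c O ψ ρ) {x : Euc m} (hx : x ∈ c) :
    Module.finrank ℝ (Submodule.span ℝ (tangentConeAt ℝ c x)) = d := by
  rw [h.tangentConeAt_eq hx, Submodule.span_eq,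
    LinearMap.finrank_range_of_inj (h.fderiv_injective (h.map_mem hx).1)]
  simp

end IsLinParam

theorem IsC2Cell.dim_unique {m d e : ℕ} {c : Set (Euc m)} (h : IsC2Cell L d c)
    (h' : IsC2Cell L e c) (hne : c.Nonempty) : d = e := by
  obtain ⟨x, hx⟩ := hne
  obtain ⟨_, _, _, hp⟩ := h.exists_isLinParam
  obtain ⟨_, _, _, hp'⟩ := h'.exists_isLinParam
  rw [← hp.finrank_span_tangentConeAt hx, ← hp'.finrank_span_tangentConeAt hx]

end EuclideanCells

/-! ### Closed skeletons, and strata that are locally one cell. -/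

namespace Stratification

open Topology

variable {L : FirstOrder.Language.{u, v}} [L.Structure ℝ] {m : ℕ} {X : Set (Euc m)}

theorem eq_of_mem (𝒳 : Stratification L X) {c c' : Set (Euc m)} (hc : c ∈ 𝒳.cells)
    (hc' : c' ∈ 𝒳.cells) {p : Euc m} (hp : p ∈ c) (hp' : p ∈ c') : c = c' := by
  by_contra hne
  exact disjoint_left.1 (𝒳.disjoint hc hc' hne) hp hp'

/-- The closure of `c` in `X` is a union of cells, so one common point puts all of `c'` in it; the
frontier inequality then applies. -/
theorem dim_lt_of_mem_closure (hL : IsPolyBoundedOMinimal L) (𝒳 : Stratification L X)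
    {c c' : Set (Euc m)} {d e : ℕ} (hc : c ∈ 𝒳.cells) (hc' : c' ∈ 𝒳.cells) (hd : IsC2Cell L d c)
    (he : IsC2Cell L e c') (hne : c ≠ c') {p : Euc m} (hp : p ∈ c') (hpc : p ∈ closure c) :
    e < d := by
  by_contra hde
  obtain ⟨D, hD, hcl⟩ := 𝒳.closure_eq c hc
  have hpX : p ∈ X := 𝒳.sUnion_eq ▸ mem_sUnion_of_mem hp hc'
  obtain ⟨c'', hc'', hp''⟩ := hcl ▸ (show p ∈ closure c ∩ X from ⟨hpc, hpX⟩)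
  rw [← 𝒳.eq_of_mem hc' (hD hc'') hp hp''] at hc''
  refine hd.not_subset_closure hL he (not_lt.1 hde) (𝒳.disjoint hc hc' hne) ⟨p, hp⟩ ?_
  exact fun x hx => (hcl.symm ▸ mem_sUnion_of_mem hx hc'' : x ∈ closure c ∩ X).1

theorem exists_cell (𝒳 : Stratification L X) {p : Euc m} (hp : p ∈ X) :
    ∃ c ∈ 𝒳.cells, p ∈ c ∧ ∃ d, IsC2Cell L d c := by
  obtain ⟨c, hc, hpc⟩ := 𝒳.sUnion_eq.symm ▸ hp
  exact ⟨c, hc, hpc, 𝒳.isCell c hc⟩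

theorem skel_mono (𝒳 : Stratification L X) {k l : ℤ} (h : k ≤ l) : 𝒳.skel k ⊆ 𝒳.skel l := by
  rintro x ⟨c, ⟨hc, d, hd, hdc⟩, hx⟩
  exact ⟨c, ⟨hc, d, hd.trans h, hdc⟩, hx⟩

theorem stratum_subset_skel (𝒳 : Stratification L X) (i : ℕ) : 𝒳.stratum i ⊆ 𝒳.skel i := by
  rintro x ⟨c, ⟨hc, hdc⟩, hx⟩
  exact ⟨c, ⟨hc, i, le_rfl, hdc⟩, hx⟩

theorem mem_stratum_of_mem_skel (𝒳 : Stratification L X) {i : ℕ} {x : Euc m}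
    (hx : x ∈ 𝒳.skel i) (hx' : x ∉ 𝒳.skel ((i : ℤ) - 1)) : x ∈ 𝒳.stratum i := by
  obtain ⟨c, ⟨hc, d, hd, hdc⟩, hxc⟩ := hx
  have : d = i := by
    by_contra hne
    exact hx' ⟨c, ⟨hc, d, by omega, hdc⟩, hxc⟩
  exact ⟨c, ⟨hc, this ▸ hdc⟩, hxc⟩

theorem notMem_skel_of_mem_stratum (𝒳 : Stratification L X) {i : ℕ} {k : ℤ} (hk : k < i)
    {x : Euc m} (hx : x ∈ 𝒳.stratum i) : x ∉ 𝒳.skel k := by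
  rintro ⟨c, ⟨hc, d, hd, hdc⟩, hxc⟩
  obtain ⟨c', ⟨hc', hdc'⟩, hxc'⟩ := hx
  obtain rfl := 𝒳.eq_of_mem hc hc' hxc hxc'
  have := hdc.dim_unique hdc' ⟨x, hxc⟩
  omega

theorem le_of_mem_stratum (𝒳 : Stratification L X) {i : ℕ} {x : Euc m}
    (hx : x ∈ 𝒳.stratum i) : i ≤ m := by
  obtain ⟨c, ⟨_, hdc⟩, _⟩ := hx
  exact hdc.le

theorem exists_mem_stratum_of_mem_skel (𝒳 : Stratification L X) {k : ℕ} {x : Euc m}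
    (hx : x ∈ 𝒳.skel k) : ∃ i ≤ k, x ∈ 𝒳.stratum i := by
  obtain ⟨c, ⟨hc, d, hd, hdc⟩, hxc⟩ := hx
  exact ⟨d, by omega, c, ⟨hc, hdc⟩, hxc⟩

theorem isClosed_skel (hL : IsPolyBoundedOMinimal L) (hX : IsClosed X) (𝒳 : Stratification L X)
    (k : ℤ) : IsClosed (𝒳.skel k) := by
  refine isClosed_of_closure_subset fun p hp => ?_
  rw [skel, (𝒳.finite.subset fun c hc => hc.1).closure_sUnion] at hp
  obtain ⟨c, ⟨hc, d, hd, hdc⟩, hpc⟩ := mem_iUnion₂.1 hp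
  have hpX : p ∈ X := by
    refine hX.closure_subset_iff.2 ?_ hpc
    exact 𝒳.sUnion_eq ▸ subset_sUnion_of_mem hc
  obtain ⟨c', hc', hpc', e, he⟩ := 𝒳.exists_cell hpX
  by_cases hcc : c = c'
  · exact ⟨c, ⟨hc, d, hd, hdc⟩, hcc ▸ hpc'⟩
  · have := 𝒳.dim_lt_of_mem_closure hL hc hc' hdc he hcc hpc' hpc
    exact ⟨c', ⟨hc', e, by omega, he⟩, hpc'⟩

/-- Distinct cells of equal dimension do not accumulate on one another. Hence the tangent space of
the stratum can be computed in the cell. -/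
theorem nhdsWithin_stratum (hL : IsPolyBoundedOMinimal L) (𝒳 : Stratification L X) {i : ℕ}
    {c : Set (Euc m)} (hc : c ∈ 𝒳.cells) (hci : IsC2Cell L i c) {p : Euc m} (hp : p ∈ c) :
    𝓝[𝒳.stratum i] p = 𝓝[c] p := by
  refine le_antisymm ?_ (nhdsWithin_mono p (subset_sUnion_of_mem ⟨hc, hci⟩))
  have hfin : {c' | c' ∈ 𝒳.cells ∧ IsC2Cell L i c' ∧ c' ≠ c}.Finite :=
    𝒳.finite.subset fun c' h => h.1
  have hnot : p ∉ closure (⋃₀ {c' | c' ∈ 𝒳.cells ∧ IsC2Cell L i c' ∧ c' ≠ c}) := by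
    rw [hfin.closure_sUnion]
    intro hp'
    obtain ⟨c', ⟨h1, h2, h3⟩, h4⟩ := mem_iUnion₂.1 hp'
    exact lt_irrefl _ (𝒳.dim_lt_of_mem_closure hL h1 hc h2 hci h3 hp h4)
  refine nhdsWithin_le_iff.2 ?_
  refine mem_nhdsWithin.2 ⟨_, isClosed_closure.isOpen_compl, hnot, ?_⟩
  rintro x ⟨hx, c', ⟨hc', hci'⟩, hxc'⟩
  by_cases h : c' = c
  · exact h ▸ hxc'
  · have hmem : x ∈ ⋃₀ {c' | c' ∈ 𝒳.cells ∧ IsC2Cell L i c' ∧ c' ≠ c} :=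
      ⟨c', ⟨hc', hci', h⟩, hxc'⟩
    exact absurd (subset_closure hmem) hx

theorem tangentSpaceOf_stratum (hL : IsPolyBoundedOMinimal L) (𝒳 : Stratification L X) {i : ℕ}
    {c : Set (Euc m)} (hc : c ∈ 𝒳.cells) (hci : IsC2Cell L i c) {O : Set (Fin i → ℝ)}
    {ψ : (Fin i → ℝ) → Euc m} {ρ : Euc m →L[ℝ] (Fin i → ℝ)} (h : IsLinParam c O ψ ρ)
    {p : Euc m} (hp : p ∈ c) :
    tangentSpaceOf (𝒳.stratum i) p = LinearMap.range (fderiv ℝ ψ (ρ p)).toLinearMap := by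
  rw [tangentSpaceOf, tangentConeAt_congr (𝒳.nhdsWithin_stratum hL hc hci hp),
    h.tangentConeAt_eq hp, Submodule.span_eq]

end Stratification

/-! ### The distance with the convention for the empty set. -/

section SetDist

variable {m : ℕ}

theorem setDist_empty (a : Euc m) : setDist a ∅ = 1 := by simp [setDist]

theorem setDist_of_nonempty (a : Euc m) {S : Set (Euc m)} (h : S.Nonempty) :
    setDist a S = Metric.infDist a S := by simp [setDist, h.ne_empty]

theorem setDist_nonneg (a : Euc m) (S : Set (Euc m)) : 0 ≤ setDist a S := by
  rcases S.eq_empty_or_nonempty with rfl | h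
  · simp [setDist_empty]
  · rw [setDist_of_nonempty a h]; exact Metric.infDist_nonneg

theorem setDist_le_dist (a : Euc m) {S : Set (Euc m)} {z : Euc m} (hz : z ∈ S) :
    setDist a S ≤ dist a z := by
  rw [setDist_of_nonempty a ⟨z, hz⟩]; exact Metric.infDist_le_dist_of_mem hz

theorem setDist_eq_zero {a : Euc m} {S : Set (Euc m)} (ha : a ∈ S) : setDist a S = 0 :=
  le_antisymm (by simpa using setDist_le_dist a ha) (setDist_nonneg a S)

theorem setDist_pos {a : Euc m} {S : Set (Euc m)} (hS : IsClosed S) (ha : a ∉ S) :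
    0 < setDist a S := by
  rcases S.eq_empty_or_nonempty with rfl | h
  · simp [setDist_empty]
  · rw [setDist_of_nonempty a h]; exact (hS.notMem_iff_infDist_pos h).1 ha

theorem setDist_le_add (a b : Euc m) (S : Set (Euc m)) : setDist a S ≤ setDist b S + dist a b := by
  rcases S.eq_empty_or_nonempty with rfl | h
  · simp [setDist_empty]
  · rw [setDist_of_nonempty a h, setDist_of_nonempty b h]
    exact Metric.infDist_le_infDist_add_dist

theorem exists_dist_eq_setDist (a : Euc m) {S : Set (Euc m)} (hS : IsClosed S) (h : S.Nonempty) :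
    ∃ z ∈ S, dist a z = setDist a S := by
  obtain ⟨z, hz, hd⟩ := hS.exists_infDist_eq_dist h a
  exact ⟨z, hz, by rw [setDist_of_nonempty a h, hd]⟩

end SetDist

/-! ### Enumerations and windows for the construction of chains. -/

section Combinatorics

theorem exists_strictAnti_enum (T : Finset ℕ) : ∀ n : ℕ, (∀ l ∈ T, l < n) →
    ∃ j : ℕ → ℕ, j 0 = n ∧ (∀ i i', i < i' → i' ≤ T.card → j i' < j i) ∧
      (∀ i, 1 ≤ i → i ≤ T.card → j i ∈ T) ∧ ∀ l ∈ T, ∃ i, 1 ≤ i ∧ i ≤ T.card ∧ j i = l := by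
  induction T using Finset.induction_on_max with
  | empty => intro n _; exact ⟨fun _ => n, rfl, by simp; omega, by simp; omega, by simp⟩
  | insert M T hM ih =>
    intro n hn
    obtain ⟨j, hj0, hanti, hmem, hsurj⟩ := ih M hM
    have hcard : (insert M T).card = T.card + 1 :=
      Finset.card_insert_of_notMem fun h => lt_irrefl _ (hM M h)
    have hjle : ∀ i ≤ T.card, j i ∈ insert M T := by
      intro i hi
      rcases Nat.eq_zero_or_pos i with rfl | hpos
      · simp [hj0]
      · exact Finset.mem_insert_of_mem (hmem i hpos hi)
    refine ⟨fun i => if i = 0 then n else j (i - 1), by simp, ?_, ?_, ?_⟩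
    · intro i i' hii hi'
      rw [hcard] at hi'
      rcases Nat.eq_zero_or_pos i with rfl | hpos
      · simpa [show i' ≠ 0 by omega] using hn _ (hjle (i' - 1) (by omega))
      · simpa [show i' ≠ 0 by omega, show i ≠ 0 by omega] using
          hanti (i - 1) (i' - 1) (by omega) (by omega)
    · intro i hi hi'
      simpa [show i ≠ 0 by omega] using hjle (i - 1) (by omega)
    · intro l hl
      rcases Finset.mem_insert.1 hl with rfl | hl
      · exact ⟨1, le_rfl, by omega, by simpa using hj0⟩
      · obtain ⟨i, h1, h2, h3⟩ := hsurj l hl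
        exact ⟨i + 1, by omega, by omega, by simpa using h3⟩

/-- Among `n + 1` disjoint windows there is one that `n` given numbers avoid. -/
theorem exists_avoided_window {c C : ℕ → ℝ} (h : ∀ r r', r < r' → C r < c r') (ρ : ℕ → ℝ)
    (n : ℕ) : ∃ r ≤ n, ∀ l < n, ρ l < c r ∨ C r < ρ l := by
  by_contra! hcon
  choose! l hl hlr using hcon
  -- If every window contained one of the numbers, two windows would contain the same one.
  obtain ⟨r, hr, r', hr', hne, heq⟩ := Finset.exists_ne_map_eq_of_card_lt_of_maps_to
    (s := Finset.range (n + 1)) (t := Finset.range n) (by simp) (f := l)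
    (fun r hr => by simpa using hl r (by simpa [Nat.lt_succ_iff] using hr))
  have key : ∀ r r', r ≤ n → r' ≤ n → r < r' → l r = l r' → False := by
    intro r r' hr hr' hlt heq
    have h1 := (hlr r hr).2
    have h2 := (hlr r' hr').1
    rw [heq] at h1
    linarith [h r r' hlt]
  simp only [Finset.mem_range, Nat.lt_succ_iff] at hr hr'
  rcases lt_or_gt_of_ne hne with hlt | hlt
  · exact key r r' hr hr' hlt heq
  · exact key r' r hr' hr hlt heq.symm

end Combinatorics

/-! ### From the Lipschitz inequalities to Whitney's condition (a). -/

section Projections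

theorem Submodule.norm_sub_starProjection_le {E : Type*} [NormedAddCommGroup E]
    [InnerProductSpace ℝ E] (K : Submodule ℝ E) [K.HasOrthogonalProjection] (v : E) {w : E}
    (hw : w ∈ K) : ‖v - K.starProjection v‖ ≤ ‖v - w‖ := by
  have h : v - K.starProjection v = Kᗮ.starProjection (v - w) := by
    rw [Submodule.starProjection_orthogonal_val, map_sub,
      Submodule.starProjection_eq_self_iff.2 hw]
    abel
  rw [h]
  exact (ContinuousLinearMap.le_of_opNorm_le _ Kᗮ.starProjection_norm_le _).trans (by simp)

end Projections

namespace Stratification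

open Topology Filter

variable {L : FirstOrder.Language.{u, v}} [L.Structure ℝ] {m : ℕ} {X : Set (Euc m)}

theorem norm_sub_proj_le (𝒳 : Stratification L X) (i : ℕ) (x v w : Euc m)
    (hw : w ∈ tangentSpaceOf (𝒳.stratum i) x) : ‖v - 𝒳.proj i x v‖ ≤ ‖v - w‖ :=
  Submodule.norm_sub_starProjection_le _ v hw

theorem norm_proj_apply_le (𝒳 : Stratification L X) (i : ℕ) (x v : Euc m) :
    ‖𝒳.proj i x v‖ ≤ ‖v‖ :=
  (ContinuousLinearMap.le_of_opNorm_le _ (Submodule.starProjection_norm_le _) v).trans (by simp)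

/-- Errors add up along the product because projections do not increase norms. -/
theorem norm_sub_projProd_le (𝒳 : Stratification L X) (a : ℕ → Euc m) (j : ℕ → ℕ) (v : Euc m)
    {ε : ℝ} (n : ℕ) : ∀ r : ℕ, (∀ t, r ≤ t → t < r + n → ‖v - 𝒳.proj (j t) (a t) v‖ ≤ ε) →
      ‖v - 𝒳.projProd a j r n v‖ ≤ n * ε := by
  induction n with
  | zero => intro r _; simp [projProd]
  | succ n ih =>
    intro r h
    have h1 := ih (r + 1) fun t ht ht' => h t (by omega) (by omega)
    have h2 := h r le_rfl (by omega)
    have e : 𝒳.projProd a j r (n + 1) v = 𝒳.proj (j r) (a r) (𝒳.projProd a j (r + 1) n v) := by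
      simp [projProd, List.range'_succ]
    have e2 : v - 𝒳.projProd a j r (n + 1) v =
        (v - 𝒳.proj (j r) (a r) v) + 𝒳.proj (j r) (a r) (v - 𝒳.projProd a j (r + 1) n v) := by
      rw [e, map_sub]; abel
    rw [e2]
    calc _ ≤ _ := norm_add_le _ _
      _ ≤ ε + n * ε := add_le_add h2 ((𝒳.norm_proj_apply_le _ _ _).trans h1)
      _ = _ := by push_cast; ring

/-- The plain chain of the nearest points of the skeletons from which `y` is relatively far. -/
theorem exists_isPlainChain (hL : IsPolyBoundedOMinimal L) (hX : IsClosed X)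
    (𝒳 : Stratification L X) {n : ℕ} {y : Euc m} (hy : y ∈ 𝒳.stratum n) {c C : ℝ} (hc : 2 ≤ c)
    (hwin : ∀ l < n, setDist y (𝒳.skel ((l : ℤ) - 1)) < c * setDist y (𝒳.skel l) ∨
      C * setDist y (𝒳.skel l) < setDist y (𝒳.skel ((l : ℤ) - 1))) :
    ∃ (k : ℕ) (a : ℕ → Euc m) (j : ℕ → ℕ), 𝒳.IsPlainChain c c C k a j ∧ k ≤ n ∧ a 0 = y ∧
      j 0 = n ∧ (∀ t, 1 ≤ t → t ≤ k → dist y (a t) = setDist y (𝒳.skel (j t))) ∧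
      ∀ l < n, c * setDist y (𝒳.skel l) ≤ setDist y (𝒳.skel ((l : ℤ) - 1)) →
        ∃ t, 1 ≤ t ∧ t ≤ k ∧ j t = l := by
  classical
  have hpos : ∀ l : ℕ, l < n → 0 < setDist y (𝒳.skel l) := fun l hl =>
    setDist_pos (𝒳.isClosed_skel hL hX l) (𝒳.notMem_skel_of_mem_stratum (by exact_mod_cast hl) hy)
  let T : Finset ℕ := (Finset.range n).filter fun l =>
    c * setDist y (𝒳.skel l) ≤ setDist y (𝒳.skel ((l : ℤ) - 1))
  have hT : ∀ l, l ∈ T ↔ l < n ∧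
      c * setDist y (𝒳.skel l) ≤ setDist y (𝒳.skel ((l : ℤ) - 1)) := by simp [T]
  obtain ⟨j, hj0, hanti, hmem, hsurj⟩ := exists_strictAnti_enum T n fun l hl => ((hT l).1 hl).1
  have hnear : ∀ l ∈ T, ∃ z ∈ 𝒳.stratum l, dist y z = setDist y (𝒳.skel l) := by
    intro l hl
    obtain ⟨hln, hlT⟩ := (hT l).1 hl
    have hp := hpos l hln
    -- If the skeleton were empty, so would be the smaller one; both distances would be 1 by
    -- convention, against $c\ge2$.
    have hne : (𝒳.skel l).Nonempty := by
      by_contra hemp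
      rw [not_nonempty_iff_eq_empty] at hemp
      have hemp' : 𝒳.skel ((l : ℤ) - 1) = ∅ :=
        subset_empty_iff.1 (hemp ▸ 𝒳.skel_mono (by omega))
      rw [hemp, hemp', setDist_empty] at hlT
      linarith
    obtain ⟨z, hz, hd⟩ := exists_dist_eq_setDist y (𝒳.isClosed_skel hL hX l) hne
    refine ⟨z, 𝒳.mem_stratum_of_mem_skel hz fun hz' => ?_, hd⟩
    have := setDist_le_dist y hz'
    nlinarith
  choose! z hz hzd using hnear
  refine ⟨T.card, fun t => if t = 0 then y else z (j t), j, ?_, ?_, by simp, hj0, ?_, ?_⟩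
  · refine ⟨?_, hanti, ?_, ?_, ?_⟩
    · intro i hi
      rcases Nat.eq_zero_or_pos i with rfl | hi0
      · simpa [hj0] using hy
      · simpa [hi0.ne'] using hz _ (hmem i hi0 hi)
    · intro i hi0 hi
      have hiT := hmem i hi0 hi
      have hp := hpos _ ((hT _).1 hiT).1
      simp only [if_true, show i ≠ 0 by omega, if_false, hzd _ hiT]
      nlinarith
    · intro i hi
      simp only [if_true]
      rcases Nat.eq_zero_or_pos i with rfl | hi0
      · rw [hj0, setDist_eq_zero (𝒳.stratum_subset_skel n hy), mul_zero]
        exact setDist_pos (𝒳.isClosed_skel hL hX _)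
          (𝒳.notMem_skel_of_mem_stratum (by omega) hy)
      · obtain ⟨h1, h2⟩ := (hT _).1 (hmem i hi0 hi)
        exact (hwin _ h1).resolve_left (not_lt.2 h2)
    · intro l hl hnot
      simp only [if_true]
      by_contra hcon
      obtain ⟨t, h1, h2, h3⟩ := hsurj l ((hT l).2 ⟨hj0 ▸ hl, not_lt.1 hcon⟩)
      exact hnot t h2 h3
  · calc T.card ≤ (Finset.range n).card := Finset.card_filter_le _ _
      _ = n := Finset.card_range n
  · intro t h1 h2
    simpa [show t ≠ 0 by omega] using hzd _ (hmem t h1 h2)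
  · exact fun l hl hlT => hsurj l ((hT l).2 ⟨hl, hlT⟩)

/-- A chain needs every ratio $d(y,X^{l-1})/d(y,X^l)$ to avoid the window $[c,C]$. Starting each `c`
beyond the previous `c` and `C` gives infinitely many disjoint windows, one of which is free for any
given point. -/
theorem exists_windows {𝒳 : Stratification L X} (h𝒳 : 𝒳.IsLipschitz) :
    ∃ c C : ℕ → ℝ, (∀ r, 2 ≤ c r) ∧ (∀ r, 0 < C r) ∧ (∀ r r', r < r' → C r < c r') ∧
      ∀ r, 𝒳.IsLipschitzWith (c r) (c r) (C r) (C r) (C r) := by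
  choose! F hFpos hF using h𝒳
  let c : ℕ → ℝ := fun r => Nat.rec 2 (fun _ x => max x (F x) + 1) r
  have hsucc : ∀ r, c (r + 1) = max (c r) (F (c r)) + 1 := fun r => rfl
  have hmono : Monotone c := monotone_nat_of_le_succ fun r => by
    rw [hsucc]; linarith [le_max_left (c r) (F (c r))]
  have h2 : ∀ r, 2 ≤ c r := fun r => hmono (Nat.zero_le r)
  refine ⟨c, fun r => F (c r), h2, fun r => hFpos _ (by linarith [h2 r]), fun r r' h => ?_,
    fun r => hF _ (by linarith [h2 r])⟩
  have := hmono (Nat.succ_le_of_lt h)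
  rw [Nat.succ_eq_add_one, hsucc] at this
  linarith [le_max_right (c r) (F (c r))]

/-- Along a single stratum the tangent spaces vary continuously. -/
theorem exists_norm_sub_proj_le_self (hL : IsPolyBoundedOMinimal L) (𝒳 : Stratification L X)
    {i : ℕ} {p : Euc m} (hp : p ∈ 𝒳.stratum i) {v : Euc m}
    (hv : v ∈ tangentSpaceOf (𝒳.stratum i) p) {ε : ℝ} (hε : 0 < ε) :
    ∃ δ > 0, ∀ y ∈ 𝒳.stratum i, dist y p < δ → ‖v - 𝒳.proj i y v‖ ≤ ε := by
  obtain ⟨c, ⟨hc, hci⟩, hpc⟩ := hp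
  obtain ⟨O, ψ, ρ, h⟩ := hci.exists_isLinParam
  rw [𝒳.tangentSpaceOf_stratum hL hc hci h hpc] at hv
  obtain ⟨w, rfl⟩ := hv
  have hO := (h.map_mem hpc).1
  have hcont : ContinuousAt (fun y => fderiv ℝ ψ (ρ y) w) p := by
    have h1 : ContinuousAt (fderiv ℝ ψ) (ρ p) :=
      (h.contDiffOn.continuousOn_fderiv_of_isOpen h.isOpen (by norm_num)).continuousAt
        (h.isOpen.mem_nhds hO)
    exact (ContinuousAt.comp (f := ρ) h1 ρ.continuous.continuousAt).clm_apply continuousAt_const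
  have h1 : ∀ᶠ y in 𝓝[𝒳.stratum i] p, y ∈ c := by
    rw [𝒳.nhdsWithin_stratum hL hc hci hpc]
    exact self_mem_nhdsWithin
  have h2 := (Metric.tendsto_nhds.1 hcont ε hε)
  obtain ⟨δ, hδ, hball⟩ := Metric.eventually_nhds_iff.1
    ((eventually_nhdsWithin_iff.1 h1).and h2)
  refine ⟨δ, hδ, fun y hy hyp => ?_⟩
  obtain ⟨hyc, hyd⟩ := hball hyp
  refine (𝒳.norm_sub_proj_le i y _ (fderiv ℝ ψ (ρ y) w) ?_).trans ?_
  · rw [𝒳.tangentSpaceOf_stratum hL hc hci h (hyc hy)]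
    exact ⟨w, rfl⟩
  · rw [← dist_eq_norm, dist_comm]
    exact hyd.le

/-- Whitney's condition (a) for Lipschitz stratifications. -/
theorem exists_norm_sub_proj_le (hL : IsPolyBoundedOMinimal L) (hX : IsClosed X)
    (𝒳 : Stratification L X) (h𝒳 : 𝒳.IsLipschitz) {i : ℕ} {p : Euc m} (hp : p ∈ 𝒳.stratum i)
    {v : Euc m} (hv : v ∈ tangentSpaceOf (𝒳.stratum i) p) (n : ℕ) :
    ∀ ε > 0, ∃ δ > 0, ∀ j < n, ∀ y ∈ 𝒳.stratum j, dist y p < δ → ‖v - 𝒳.proj j y v‖ ≤ ε := by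
  induction n with
  | zero => exact fun ε _ => ⟨1, one_pos, by simp⟩
  | succ n ih =>
    intro ε hε
    suffices H : ∃ δ > 0, ∀ y ∈ 𝒳.stratum n, dist y p < δ → ‖v - 𝒳.proj n y v‖ ≤ ε by
      obtain ⟨δ₁, h1, H1⟩ := H
      obtain ⟨δ₂, h2, H2⟩ := ih ε hε
      refine ⟨min δ₁ δ₂, lt_min h1 h2, fun j hj y hy hd => ?_⟩
      rcases Nat.lt_succ_iff_lt_or_eq.1 hj with hj | rfl
      · exact H2 j hj y hy (hd.trans_le (min_le_right _ _))
      · exact H1 y hy (hd.trans_le (min_le_left _ _))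
    have hρ : 0 < setDist p (𝒳.skel ((i : ℤ) - 1)) :=
      setDist_pos (𝒳.isClosed_skel hL hX _) (𝒳.notMem_skel_of_mem_stratum (by omega) hp)
    set ρ := setDist p (𝒳.skel ((i : ℤ) - 1)) with hρdef
    -- Strata of dimension below `i` stay at distance at least `ρ` from `p`; for `n = i` the tangent
    -- spaces are continuous. Only `n > i` needs chains.
    rcases lt_trichotomy n i with hni | rfl | hni
    · refine ⟨ρ, hρ, fun y hy hd => ?_⟩
      have h1 := setDist_le_dist p (𝒳.skel_mono (show (n : ℤ) ≤ (i : ℤ) - 1 by omega)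
        (𝒳.stratum_subset_skel n hy))
      rw [dist_comm] at h1
      linarith
    · exact 𝒳.exists_norm_sub_proj_le_self hL hp hv hε
    obtain ⟨c, C, hc2, hCpos, hlt, hLip⟩ := exists_windows h𝒳
    obtain ⟨δ, hδ, hδP⟩ := ih (ε / (2 * (n + 1))) (by positivity)
    -- The window depends on `y`; `K` bounds the constants of all windows that can occur.
    let K := ∑ r ∈ Finset.range (n + 1), (c r + C r)
    have hK : ∀ r ≤ n, c r + C r ≤ K := fun r hr =>
      Finset.single_le_sum (f := fun r => c r + C r)
        (fun r _ => by have := hc2 r; have := hCpos r; linarith)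
        (Finset.mem_range.2 (Nat.lt_succ_of_le hr))
    have hKpos : 0 < K := by have := hK 0 (Nat.zero_le n); have := hc2 0; have := hCpos 0; linarith
    refine ⟨min (min (δ / 2) (ρ / 2)) (min (ρ / (2 * K)) (ε * ρ / (4 * K * (‖v‖ + 1)))),
      by positivity, fun y hy hd => ?_⟩
    have hd1 : dist y p < δ / 2 := hd.trans_le ((min_le_left _ _).trans (min_le_left _ _))
    have hd2 : dist y p < ρ / 2 := hd.trans_le ((min_le_left _ _).trans (min_le_right _ _))
    have hd3 : dist y p < ρ / (2 * K) := hd.trans_le ((min_le_right _ _).trans (min_le_left _ _))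
    have hd4 : dist y p < ε * ρ / (4 * K * (‖v‖ + 1)) :=
      hd.trans_le ((min_le_right _ _).trans (min_le_right _ _))
    rw [lt_div_iff₀ (by positivity)] at hd3 hd4
    have hd0 : 0 ≤ dist y p := dist_nonneg
    have hpos : ∀ l : ℕ, l < n → 0 < setDist y (𝒳.skel l) := fun l hl =>
      setDist_pos (𝒳.isClosed_skel hL hX l)
        (𝒳.notMem_skel_of_mem_stratum (by exact_mod_cast hl) hy)
    obtain ⟨r, hr, hwin⟩ := exists_avoided_window hlt
      (fun l => setDist y (𝒳.skel ((l : ℤ) - 1)) / setDist y (𝒳.skel l)) n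
    obtain ⟨k, a, j, hchain, hkn, ha0, hj0, had, hsurj⟩ := 𝒳.exists_isPlainChain hL hX hy (hc2 r)
      (C := C r) (fun l hl => by
        have := hwin l hl
        rwa [div_lt_iff₀ (hpos l hl), lt_div_iff₀ (hpos l hl)] at this)
    have hKr := hK r hr
    have hcr := hc2 r
    have hCr := hCpos r
    have hρy : ρ / 2 ≤ setDist y (𝒳.skel ((i : ℤ) - 1)) := by
      have := setDist_le_add p y (𝒳.skel ((i : ℤ) - 1))
      rw [dist_comm] at this
      linarith
    have hdle : ∀ l : ℕ, i ≤ l → setDist y (𝒳.skel l) ≤ dist y p := fun l hl =>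
      setDist_le_dist y (𝒳.skel_mono (by exact_mod_cast hl) (𝒳.stratum_subset_skel i hp))
    -- The chain visits dimension `i`, since $d(y,X^i)\le|y-p|$ is small against
    -- $d(y,X^{i-1})\ge\rho/2$. It is used only up to this place, where all its points are near `p`.
    obtain ⟨s, hs1, hsk, hsi⟩ := hsurj i hni (by
      have h1 := hdle i le_rfl
      have h2 : c r * setDist y (𝒳.skel i) ≤ K * dist y p :=
        mul_le_mul (by linarith) h1 (setDist_nonneg _ _) hKpos.le
      nlinarith)
    have hji : ∀ t ≤ s, i ≤ j t := by
      intro t ht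
      rcases Nat.lt_or_eq_of_le ht with h | rfl
      · have := hchain.strictAnti t s h hsk
        omega
      · exact hsi.ge
    have hjn : ∀ t, 1 ≤ t → t ≤ s → j t < n := fun t h1 h2 =>
      hj0 ▸ hchain.strictAnti 0 t h1 (h2.trans hsk)
    have hprod := 𝒳.norm_sub_projProd_le a j v (ε := ε / (2 * (n + 1))) s 1 fun t h1 h2 => by
      have hts : t ≤ s := by omega
      refine hδP (j t) (hjn t h1 hts) (a t) (hchain.mem t (hts.trans hsk)) ?_
      calc dist (a t) p ≤ dist (a t) y + dist y p := dist_triangle _ _ _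
        _ < δ := by
          rw [dist_comm, had t h1 (hts.trans hsk)]
          linarith [hdle (j t) (hji t hts)]
    have hbound := (hLip r).1 k a j hchain s hs1 hsk
    rw [ha0, hj0, hsi, had 1 le_rfl (hs1.trans hsk)] at hbound
    set S := 𝒳.projProd a j 1 s
    have hdiv : setDist y (𝒳.skel (j 1)) / setDist y (𝒳.skel ((i : ℤ) - 1)) ≤
        dist y p / (ρ / 2) :=
      div_le_div₀ hd0 (hdle _ (hji 1 hs1)) (by positivity) hρy
    have hnorm : ‖(1 - 𝒳.proj n y) * S‖ ≤ K * (dist y p / (ρ / 2)) :=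
      hbound.trans (mul_le_mul (by linarith) hdiv
        (div_nonneg (setDist_nonneg _ _) (setDist_nonneg _ _)) hKpos.le)
    -- By induction the projections at $a_1,\dots,a_s$ nearly fix $v$, so $Sv\approx v$; the
    -- Lipschitz inequality makes the remaining term $O(|y-p|/\rho)$.
    have hsplit : v - 𝒳.proj n y v =
        ((v - S v) - 𝒳.proj n y (v - S v)) + ((1 - 𝒳.proj n y) * S) v := by
      simp only [mul_apply_eq_comp, sub_apply, one_apply_eq_self, map_sub]
      abel
    have hfirst : ‖(v - S v) - 𝒳.proj n y (v - S v)‖ ≤ ε / 2 := by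
      refine (𝒳.norm_sub_proj_le n y _ 0 (Submodule.zero_mem _)).trans ?_
      rw [sub_zero]
      refine hprod.trans ?_
      have hsn : (s : ℝ) ≤ n + 1 := by
        have : (s : ℝ) ≤ n := by exact_mod_cast hsk.trans hkn
        linarith
      calc (s : ℝ) * (ε / (2 * (n + 1))) ≤ (n + 1) * (ε / (2 * (n + 1))) := by gcongr
        _ = ε / 2 := by field_simp
    have hsecond : ‖((1 - 𝒳.proj n y) * S) v‖ ≤ ε / 2 := by
      refine (ContinuousLinearMap.le_of_opNorm_le _ hnorm v).trans ?_
      have e : K * (dist y p / (ρ / 2)) * ‖v‖ = (dist y p * (4 * K * ‖v‖)) / (2 * ρ) := by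
        field_simp
        ring
      rw [e, div_le_iff₀ (by positivity)]
      have : dist y p * (4 * K * ‖v‖) ≤ dist y p * (4 * K * (‖v‖ + 1)) := by
        gcongr
        linarith
      linarith
    rw [hsplit]
    linarith [norm_add_le ((v - S v) - 𝒳.proj n y (v - S v)) (((1 - 𝒳.proj n y) * S) v)]

end Stratification

/-! ### Moving along a skeleton in a direction tangent to a stratum. -/

namespace Stratification

open Topology Filter

variable {L : FirstOrder.Language.{u, v}} [L.Structure ℝ] {m : ℕ} {X : Set (Euc m)}

/-- A curve in a stratum with prescribed tangent vector. -/
theorem exists_curve (hL : IsPolyBoundedOMinimal L) (𝒳 : Stratification L X) {j : ℕ} {z : Euc m}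
    (hz : z ∈ 𝒳.stratum j) {w : Euc m} (hw : w ∈ tangentSpaceOf (𝒳.stratum j) z) (x : ℝ) :
    ∃ γ : ℝ → Euc m, γ x = z ∧ HasDerivAt γ w x ∧ ∀ᶠ s in 𝓝 x, γ s ∈ 𝒳.stratum j := by
  obtain ⟨c, ⟨hc, hcj⟩, hzc⟩ := hz
  obtain ⟨O, ψ, ρ, h⟩ := hcj.exists_isLinParam
  rw [𝒳.tangentSpaceOf_stratum hL hc hcj h hzc] at hw
  obtain ⟨a, rfl⟩ := hw
  obtain ⟨hO, hψ⟩ := h.map_mem hzc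
  have hline : HasDerivAt (fun s : ℝ => ρ z + (s - x) • a) a x := by
    simpa using (((hasDerivAt_id x).sub_const x).smul_const a).const_add (ρ z)
  have hx : ρ z + (x - x) • a = ρ z := by simp
  refine ⟨fun s => ψ (ρ z + (s - x) • a), by simp [hψ], ?_, ?_⟩
  · have h' := h.hasFDerivAt hO
    rw [← hx] at h'
    have := h'.comp_hasDerivAt x hline
    rwa [hx] at this
  · have : ∀ᶠ s in 𝓝 x, ρ z + (s - x) • a ∈ O :=
      hline.continuousAt.eventually_mem (hx.symm ▸ h.isOpen.mem_nhds hO)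
    filter_upwards [this] with s hs
    exact ⟨c, ⟨hc, hcj⟩, h.mapsTo hs⟩

/-- Vectors tangent to a stratum are regular (Clarke) tangent vectors of the skeletons that
contain the stratum. -/
theorem exists_dist_add_smul_le (hL : IsPolyBoundedOMinimal L) (hX : IsClosed X)
    (𝒳 : Stratification L X) (h𝒳 : 𝒳.IsLipschitz) {i : ℕ} (k : ℕ) {p : Euc m}
    (hp : p ∈ 𝒳.stratum i) {v : Euc m} (hv : v ∈ tangentSpaceOf (𝒳.stratum i) p) {ε : ℝ}
    (hε : 0 < ε) :
    ∃ τ > 0, ∀ y ∈ 𝒳.skel k, dist y p < τ → ∀ t, 0 ≤ t → t ≤ τ →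
      ∃ z ∈ 𝒳.skel k, dist (y + t • v) z ≤ ε * t := by
  obtain ⟨δ, hδ, H⟩ := 𝒳.exists_norm_sub_proj_le hL hX h𝒳 hp hv (k + 1) (ε / 2) (half_pos hε)
  refine ⟨δ / (2 * ‖v‖ + 1), by positivity, fun y hy hyp t ht htτ => ?_⟩
  set τ := δ / (2 * ‖v‖ + 1)
  have hτ : τ * (2 * ‖v‖ + 1) = δ := div_mul_cancel₀ _ (by positivity)
  have hcl := 𝒳.isClosed_skel hL hX k
  have hne : (𝒳.skel k).Nonempty := ⟨y, hy⟩
  set g : ℝ → ℝ := fun s => Metric.infDist (y + s • v) (𝒳.skel k) with hg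
  have hgc : Continuous g := (Metric.continuous_infDist_pt _).comp (by fun_prop)
  -- The right-hand growth rate of `g` is at most `ε / 2`: a nearest point `z` moves in its own
  -- stratum with velocity the projection of `v`, which differs from `v` by at most `ε / 2`.
  -- Comparison with the line of slope `ε` gives the bound.
  have key : ∀ ⦃s⦄, s ∈ Icc 0 t → g s ≤ ε * s := by
    refine image_le_of_liminf_slope_right_lt_deriv_boundary' (f' := fun _ => ε / 2)
      (B' := fun _ => ε) hgc.continuousOn ?_ (by simp [hg, Metric.infDist_zero_of_mem hy])
      (by fun_prop) (fun x _ => ((hasDerivAt_id x).const_mul ε).hasDerivWithinAt.congr_deriv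
        (by simp)) (fun _ _ _ => by linarith)
    intro x hx r hr
    obtain ⟨z, hz, hzd⟩ := hcl.exists_infDist_eq_dist hne (y + x • v)
    obtain ⟨j, hj, hzj⟩ := 𝒳.exists_mem_stratum_of_mem_skel hz
    have hxv : dist (y + x • v) y ≤ τ * ‖v‖ := by
      rw [dist_eq_norm, add_sub_cancel_left, norm_smul, Real.norm_of_nonneg hx.1]
      exact mul_le_mul_of_nonneg_right (hx.2.le.trans htτ) (norm_nonneg v)
    have hzx : dist z (y + x • v) ≤ τ * ‖v‖ := by
      rw [dist_comm, ← hzd]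
      exact (Metric.infDist_le_dist_of_mem hy).trans hxv
    have hzp : dist z p < δ := by
      have h1 := dist_triangle z (y + x • v) p
      have h2 := dist_triangle (y + x • v) y p
      linarith
    have hw := H j (Nat.lt_succ_of_le hj) z hzj hzp
    obtain ⟨γ, hγx, hγ, hγmem⟩ := 𝒳.exists_curve hL hzj
      (Submodule.starProjection_apply_mem (tangentSpaceOf (𝒳.stratum j) z) v) x
    change HasDerivAt γ (𝒳.proj j z v) x at hγ
    have ho := (hasDerivAt_iff_isLittleO.1 hγ).def (half_pos (sub_pos.2 hr))
    refine Eventually.frequently ?_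
    filter_upwards [self_mem_nhdsWithin, nhdsWithin_le_nhds ho, nhdsWithin_le_nhds hγmem]
      with s hs hso hsm
    have hs0 : 0 < s - x := sub_pos.2 hs
    rw [hγx, Real.norm_of_nonneg hs0.le] at hso
    have hgs : g s ≤ ‖y + s • v - γ s‖ := by
      rw [← dist_eq_norm]
      exact Metric.infDist_le_dist_of_mem (𝒳.skel_mono (by exact_mod_cast hj)
        (𝒳.stratum_subset_skel j hsm))
    have hsplit : y + s • v - γ s = (y + x • v - z) + (s - x) • (v - 𝒳.proj j z v) -
        (γ s - z - (s - x) • 𝒳.proj j z v) := by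
      module
    have hgx : g x = ‖y + x • v - z‖ := by rw [← dist_eq_norm]; exact hzd
    have hmid : ‖(s - x) • (v - 𝒳.proj j z v)‖ ≤ (s - x) * (ε / 2) := by
      rw [norm_smul, Real.norm_of_nonneg hs0.le]
      exact mul_le_mul_of_nonneg_left hw hs0.le
    rw [hsplit] at hgs
    have h1 := norm_sub_le ((y + x • v - z) + (s - x) • (v - 𝒳.proj j z v))
      (γ s - z - (s - x) • 𝒳.proj j z v)
    have h2 := norm_add_le (y + x • v - z) ((s - x) • (v - 𝒳.proj j z v))
    rw [slope_def_field, div_lt_iff₀ hs0]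
    nlinarith
  obtain ⟨z, hz, hzd⟩ := hcl.exists_infDist_eq_dist hne (y + t • v)
  exact ⟨z, hz, hzd ▸ key ⟨ht, le_rfl⟩⟩

end Stratification

/-! ### Entering `U` across a hypersurface with corners. -/

section LocalEstimate

open Topology Filter

variable {m : ℕ}

/-- If near `p` the open set `U` contains the side `h > 0` of `h = 0`, and contains the other side
or misses it, then points of `K` near `U` can be pushed into `U` along the direction `v`. -/
theorem exists_dist_le_of_side {U K : Set (Euc m)} {p v : Euc m} {h : Euc m → ℝ}
    {h' : Euc m →L[ℝ] ℝ} (hh : HasStrictFDerivAt h h' p) (hv : 0 < h' v)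
    (hK : ∀ ε > 0, ∃ τ > 0, ∀ y ∈ K, dist y p < τ → ∀ t, 0 ≤ t → t ≤ τ →
      ∃ z ∈ K, dist (y + t • v) z ≤ ε * t)
    (hpos : ∀ᶠ x in 𝓝 p, 0 < h x → x ∈ U)
    (hneg : (∀ᶠ x in 𝓝 p, h x < 0 → x ∈ U) ∨ ∀ᶠ x in 𝓝 p, h x < 0 → x ∉ U) :
    ∃ δ > 0, ∃ Q : ℝ, ∀ x ∈ U, ∀ y ∈ K \ U, dist x p < δ → dist y p < δ →
      ∃ z ∈ U ∩ K, dist x z ≤ Q * dist x y := by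
  set κ := h' v with hκ
  set M := ‖h'‖ + 1 with hM
  have hM0 : 0 < M := by positivity
  set ε := κ / (4 * M) with hε
  have hε0 : 0 < ε := by positivity
  set η := min 1 (κ / (4 * (‖v‖ + ε))) with hη
  have hvε : 0 < ‖v‖ + ε := by positivity
  have hη0 : 0 < η := by positivity
  obtain ⟨τ, hτ, hτK⟩ := hK ε hε0
  have hstrict := hh.isLittleO.def hη0
  rw [nhds_prod_eq] at hstrict
  obtain ⟨P, hP, hP'⟩ := Filter.eventually_prod_self_iff
    (r := fun a b => ‖h a - h b - h' (a - b)‖ ≤ η * ‖a - b‖) |>.1 hstrict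
  -- If `y ∉ U` has `h y < 0`, the negative side misses `U`, so points of `U` have `h ≥ 0`. This
  -- bounds `h y` below by a multiple of `-dist x y`.
  have hflip : ∀ᶠ q in 𝓝 p ×ˢ 𝓝 p, q.1 ∈ U → q.2 ∉ U → h q.2 < 0 → 0 ≤ h q.1 := by
    rcases hneg with hn | hn
    · exact (hn.prod_inr _).mono fun q hq _ hqU hlt => absurd (hq hlt) hqU
    · exact (hn.prod_inl _).mono fun q hq hqU _ _ => not_lt.1 fun hlt => hq hlt hqU
  obtain ⟨P₂, hP₂, hP₂'⟩ := Filter.eventually_prod_self_iff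
    (r := fun a b => a ∈ U → b ∉ U → h b < 0 → 0 ≤ h a) |>.1 hflip
  obtain ⟨δ₀, hδ₀, hball⟩ := Metric.eventually_nhds_iff.1
    ((eventually_mem_set.2 hP).and ((eventually_mem_set.2 hP₂).and hpos))
  -- A push of length parameter `A * d` raises `h` by at least `A * d * (κ / 2) = 2 * (M * d)`,
  -- while `h y ≥ -(M * d)`; so `h z > 0`. The choices of `ε` and `η` each cost at most a quarter of
  -- the linear gain.
  set A := 4 * M / κ with hA
  have hA0 : 0 < A := by positivity
  refine ⟨min (τ / (2 * A + 1)) (δ₀ / (2 * A * (‖v‖ + ε) + 1)), by positivity,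
    1 + A * (‖v‖ + ε), fun x hx y hy hxp hyp => ?_⟩
  have hxp1 := hxp.trans_le (min_le_left _ _)
  have hyp1 := hyp.trans_le (min_le_left _ _)
  have hxp2 := hxp.trans_le (min_le_right _ _)
  have hyp2 := hyp.trans_le (min_le_right _ _)
  rw [lt_div_iff₀ (by positivity)] at hxp1 hyp1 hxp2 hyp2
  have hx0 : 0 ≤ dist x p := dist_nonneg
  have hy0 : 0 ≤ dist y p := dist_nonneg
  set d := dist x y with hd
  have hd0 : 0 < d := dist_pos.2 fun hxy => hy.2 (hxy ▸ hx)
  have hdle : d ≤ dist x p + dist y p := by rw [hd, dist_comm y p]; exact dist_triangle _ _ _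
  have hAd : A * d ≤ A * (dist x p + dist y p) := mul_le_mul_of_nonneg_left hdle hA0.le
  have hAd' : A * (‖v‖ + ε) * d ≤ A * (‖v‖ + ε) * (dist x p + dist y p) :=
    mul_le_mul_of_nonneg_left hdle (by positivity)
  have hpos' : 0 < A * (‖v‖ + ε) := by positivity
  have hxδ : dist x p < δ₀ := by nlinarith
  have hyδ : dist y p < δ₀ := by nlinarith
  obtain ⟨z, hzK, hz⟩ := hτK y hy.1 (by nlinarith) (A * d) (by positivity) (by nlinarith)
  have hyz : dist y z ≤ A * (‖v‖ + ε) * d := by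
    have h1 := dist_triangle y (y + (A * d) • v) z
    have h2 : dist y (y + (A * d) • v) = A * d * ‖v‖ := by
      rw [dist_comm, dist_eq_norm, add_sub_cancel_left, norm_smul,
        Real.norm_of_nonneg (by positivity)]
    nlinarith
  have hzδ : dist z p < δ₀ := by
    have h1 := dist_triangle z y p
    rw [dist_comm z y] at h1
    nlinarith
  obtain ⟨hxP, hxP₂, -⟩ := hball hxδ
  obtain ⟨hyP, hyP₂, hyU⟩ := hball hyδ
  obtain ⟨hzP, -, hzU⟩ := hball hzδ
  have hη1 : η ≤ 1 := min_le_left _ _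
  have hη2 : η * (‖v‖ + ε) ≤ κ / 4 := by
    calc η * (‖v‖ + ε) ≤ κ / (4 * (‖v‖ + ε)) * (‖v‖ + ε) :=
          mul_le_mul_of_nonneg_right (min_le_right _ _) hvε.le
      _ = κ / 4 := by field_simp
  have hyh : -(M * d) ≤ h y := by
    rcases lt_or_ge (h y) 0 with hlt | hge
    · have h1 := hP₂' x hxP₂ y hyP₂ hx hy.2 hlt
      have h2 := hP' x hxP y hyP
      rw [← dist_eq_norm x y, ← hd, Real.norm_eq_abs, abs_le] at h2
      have h3 : |h' (x - y)| ≤ ‖h'‖ * d := by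
        rw [hd, dist_eq_norm]; exact h'.le_opNorm _
      have h4 := (abs_le.1 h3).2
      have h5 : η * d ≤ 1 * d := mul_le_mul_of_nonneg_right hη1 hd0.le
      rw [hM]
      linarith [h2.2]
    · have : 0 < M * d := by positivity
      linarith
  have hgain : A * d * (κ / 2) ≤ h z - h y := by
    have h2 := hP' z hzP y hyP
    rw [← dist_eq_norm z y, dist_comm z y, Real.norm_eq_abs, abs_le] at h2
    have h3 : h' (z - y) = A * d * κ - h' (y + (A * d) • v - z) := by
      simp only [map_sub, map_add, map_smul, smul_eq_mul, ← hκ]; ring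
    have h4 : h' (y + (A * d) • v - z) ≤ ‖h'‖ * (ε * (A * d)) := by
      refine (le_abs_self _).trans ((h'.le_opNorm _).trans ?_)
      rw [← dist_eq_norm]
      exact mul_le_mul_of_nonneg_left hz (norm_nonneg _)
    have h5 : ‖h'‖ * (ε * (A * d)) ≤ M * (ε * (A * d)) :=
      mul_le_mul_of_nonneg_right (by rw [hM]; linarith) (by positivity)
    have h6 : M * (ε * (A * d)) = A * d * (κ / 4) := by
      rw [hε]; field_simp
    have h7 : η * dist y z ≤ A * d * (κ / 4) := by
      calc η * dist y z ≤ η * (A * (‖v‖ + ε) * d) := mul_le_mul_of_nonneg_left hyz hη0.le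
        _ = A * d * (η * (‖v‖ + ε)) := by ring
        _ ≤ _ := mul_le_mul_of_nonneg_left hη2 (by positivity)
    linarith [h2.1]
  have hAκ : A * d * (κ / 2) = 2 * (M * d) := by
    rw [hA]; field_simp; norm_num
  have hMd : 0 < M * d := by positivity
  refine ⟨z, ⟨hzU (by linarith), hzK⟩, ?_⟩
  calc dist x z ≤ d + dist y z := dist_triangle _ _ _
    _ ≤ (1 + A * (‖v‖ + ε)) * d := by linarith

theorem IsPreconnected.subset_or_disjoint_of_frontier {α : Type*} [TopologicalSpace α]
    {s U : Set α} (hs : IsPreconnected s) (hU : IsOpen U) (h : Disjoint s (frontier U)) :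
    s ⊆ U ∨ Disjoint s U := by
  rcases hs.subset_or_subset hU isClosed_closure.isOpen_compl
    (disjoint_compl_right.mono_left subset_closure) (fun x hx => by
      by_contra hc
      rw [mem_union, not_or, notMem_compl_iff] at hc
      exact disjoint_left.1 h hx ⟨hc.2, by rw [hU.interior_eq]; exact hc.1⟩) with h1 | h1
  · exact Or.inl h1
  · exact Or.inr (disjoint_compl_left.mono h1 subset_closure)

/-- A defining function of a hypersurface `frontier U` near a corner point, with the position of
`U` with respect to its two sides. -/
theorem exists_sides {U : Set (Euc m)} (hU : IsOpen U) {l : ℕ} {p : Euc m}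
    (hp : p ∈ cornerSet (frontier U) l) :
    ∃ (h : Euc m → ℝ) (h' : Euc m →L[ℝ] ℝ), HasStrictFDerivAt h h' p ∧ h' ≠ 0 ∧
      (∀ v ∈ tangentSpaceOf (cornerSet (frontier U) l) p, h' v = 0) ∧
      ((∀ᶠ x in 𝓝 p, 0 < h x → x ∈ U) ∨ ∀ᶠ x in 𝓝 p, 0 < h x → x ∉ U) ∧
      ((∀ᶠ x in 𝓝 p, h x < 0 → x ∈ U) ∨ ∀ᶠ x in 𝓝 p, h x < 0 → x ∉ U) ∧
      ((∀ᶠ x in 𝓝 p, 0 < h x → x ∈ U) ∨ ∀ᶠ x in 𝓝 p, h x < 0 → x ∈ U) := by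
  obtain ⟨Φ, i₀, J, hps, hp0, hΦ, hΦs, -, -, hB⟩ := id hp
  have hpB : p ∈ frontier U := (hB p hps).2 ⟨by simp [hp0], by simp [hp0]⟩
  have hΦp : ContDiffAt ℝ 2 Φ p := hΦ.contDiffAt (Φ.open_source.mem_nhds hps)
  have hsrc : Φ.source ∈ 𝓝 p := Φ.open_source.mem_nhds hps
  have h0t : (0 : Euc m) ∈ Φ.target := hp0 ▸ Φ.map_source hps
  let π : Euc m →L[ℝ] ℝ := EuclideanSpace.proj i₀
  have hΦd : HasStrictFDerivAt Φ (fderiv ℝ Φ p) p := hΦp.hasStrictFDerivAt (by norm_num)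
  have hh : HasStrictFDerivAt (fun x => Φ x i₀) (π.comp (fderiv ℝ Φ p)) p :=
    π.hasStrictFDerivAt.comp p hΦd
  obtain ⟨r, hr, hrt⟩ := Metric.isOpen_iff.1 Φ.open_target 0 h0t
  have hball : ∀ᶠ x in 𝓝 p, x ∈ Φ.source ∧ Φ x ∈ Metric.ball (0 : Euc m) r :=
    (eventually_mem_set.2 hsrc).and (hΦd.continuousAt.eventually_mem
      (by rw [hp0]; exact Metric.ball_mem_nhds 0 hr))
  -- The image of a convex piece off the hyperplane is connected and misses the frontier, so it lies
  -- in `U` or outside it. Only the sign of `h` matters, not the corner coordinates.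
  have hside : ∀ A : Set (Euc m), Convex ℝ A → A ⊆ Metric.ball 0 r → (∀ y ∈ A, y i₀ ≠ 0) →
      (∀ᶠ x in 𝓝 p, Φ x ∈ A → x ∈ U) ∨ (∀ᶠ x in 𝓝 p, Φ x ∈ A → x ∉ U) := by
    intro A hA hAr hA0
    have hpre : IsPreconnected (Φ.symm '' A) := hA.isPreconnected.image _
      (Φ.continuousOn_symm.mono (hAr.trans hrt))
    have hdis : Disjoint (Φ.symm '' A) (frontier U) := by
      rw [disjoint_left]
      rintro _ ⟨y, hy, rfl⟩ hyB
      have hyt := hrt (hAr hy)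
      have := ((hB _ (Φ.map_target hyt)).1 hyB).1
      rw [Φ.right_inv hyt] at this
      exact hA0 y hy this
    rcases hpre.subset_or_disjoint_of_frontier hU hdis with h | h
    · left
      filter_upwards [hsrc] with x hx hxA
      exact h ⟨_, hxA, Φ.left_inv hx⟩
    · right
      filter_upwards [hsrc] with x hx hxA
      exact disjoint_left.1 h ⟨_, hxA, Φ.left_inv hx⟩
  have hplus : (∀ᶠ x in 𝓝 p, 0 < Φ x i₀ → x ∈ U) ∨ ∀ᶠ x in 𝓝 p, 0 < Φ x i₀ → x ∉ U := by
    refine (hside (Metric.ball 0 r ∩ {y | 0 < π y})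
      ((convex_ball 0 r).inter (convex_halfSpace_gt π.toLinearMap.isLinear 0))
      inter_subset_left fun y hy => (show 0 < y i₀ from hy.2).ne').imp ?_ ?_ <;>
    · intro hev
      filter_upwards [hev, hball] with x h1 h2 h3 using h1 ⟨h2.2, h3⟩
  have hminus : (∀ᶠ x in 𝓝 p, Φ x i₀ < 0 → x ∈ U) ∨ ∀ᶠ x in 𝓝 p, Φ x i₀ < 0 → x ∉ U := by
    refine (hside (Metric.ball 0 r ∩ {y | π y < 0})
      ((convex_ball 0 r).inter (convex_halfSpace_lt π.toLinearMap.isLinear 0))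
      inter_subset_left fun y hy => (show y i₀ < 0 from hy.2).ne).imp ?_ ?_ <;>
    · intro hev
      filter_upwards [hev, hball] with x h1 h2 h3 using h1 ⟨h2.2, h3⟩
  refine ⟨_, _, hh, ?_, ?_, hplus, hminus, ?_⟩
  · intro hzero
    have hs : HasFDerivAt Φ.symm (fderiv ℝ Φ.symm 0) (Φ p) := by
      rw [hp0]
      exact ((hΦs.contDiffAt (Φ.open_target.mem_nhds h0t)).differentiableAt
        (by norm_num)).hasFDerivAt
    have hinv : Φ.symm (Φ p) = p := Φ.left_inv hps
    have hcomp : HasFDerivAt (fun y => Φ (Φ.symm y) i₀)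
        ((π.comp (fderiv ℝ Φ p)).comp (fderiv ℝ Φ.symm 0)) (Φ p) :=
      HasFDerivAt.comp (g := fun x => Φ x i₀) (Φ p) (by rw [hinv]; exact hh.hasFDerivAt) hs
    have hπ : HasFDerivAt (fun y => Φ (Φ.symm y) i₀) π (Φ p) :=
      π.hasFDerivAt.congr_of_eventuallyEq
        (eventuallyEq_of_mem (Φ.open_target.mem_nhds (Φ.map_source hps)) fun y hy => by
          simp only [Φ.right_inv hy]; rfl)
    have heq := hπ.unique hcomp
    rw [hzero, ContinuousLinearMap.zero_comp] at heq
    have h1 : π (EuclideanSpace.single i₀ 1) = 0 := by rw [heq]; rfl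
    simp [π] at h1
  · intro v hv
    refine (Submodule.span_le (p := LinearMap.ker (π.comp (fderiv ℝ Φ p)).toLinearMap)).2 ?_ hv
    intro w hw
    refine hh.hasFDerivAt.eq_zero_of_mem_tangentConeAt (by simp [hp0]) ?_ hw
    filter_upwards [self_mem_nhdsWithin, nhdsWithin_le_nhds hsrc] with x hx hxs
    obtain ⟨Ψ, j₀, J', hxs', hx0, -, -, -, -, hB'⟩ := hx
    exact ((hB x hxs).1 ((hB' x hxs').2 ⟨by simp [hx0], by simp [hx0]⟩)).1
  -- If `U` missed both sides, its points near `p` would all have `h = 0`; but `U` is open and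
  -- accumulates at `p`, so it contains nearby points with `h > 0`.
  · by_contra hcon
    rw [not_or] at hcon
    have hplus' := hplus.resolve_left hcon.1
    have hminus' := hminus.resolve_left hcon.2
    obtain ⟨W, hW, hWo, hpW⟩ := eventually_nhds_iff.1
      (hplus'.and (hminus'.and (eventually_mem_set.2 hsrc)))
    obtain ⟨x, hxW, hxU⟩ := mem_closure_iff.1 (frontier_subset_closure hpB) W hWo hpW
    have hxs := (hW x hxW).2.2
    have hx0 : Φ x i₀ = 0 := by
      by_contra hne
      rcases lt_or_gt_of_ne hne with hlt | hlt
      · exact (hW x hxW).2.1 hlt hxU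
      · exact (hW x hxW).1 hlt hxU
    have hcont : ContinuousAt (fun t : ℝ => Φ.symm (Φ x + t • EuclideanSpace.single i₀ 1)) 0 := by
      refine ContinuousAt.comp (g := Φ.symm) ?_ (by fun_prop)
      simpa using Φ.continuousAt_symm (Φ.map_source hxs)
    have hcont' : ContinuousAt (fun t : ℝ => Φ x + t • EuclideanSpace.single i₀ (1 : ℝ)) 0 := by
      fun_prop
    have h1 : ∀ᶠ t : ℝ in 𝓝 0,
        Φ.symm (Φ x + t • EuclideanSpace.single i₀ 1) ∈ W ∩ U :=
      hcont.eventually_mem (by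
        simpa [Φ.left_inv hxs] using (hWo.inter hU).mem_nhds ⟨hxW, hxU⟩)
    have h2 : ∀ᶠ t : ℝ in 𝓝 0, Φ x + t • EuclideanSpace.single i₀ 1 ∈ Φ.target :=
      hcont'.eventually_mem (by
        simpa using Φ.open_target.mem_nhds (Φ.map_source hxs))
    obtain ⟨t, ⟨ht1, ht2⟩, ht⟩ := (((h1.and h2).filter_mono nhdsWithin_le_nhds).and
      (self_mem_nhdsWithin : Ioi (0 : ℝ) ∈ 𝓝[>] 0)).exists
    refine (hW _ ht1.1).1 ?_ ht1.2
    rw [Φ.right_inv ht2]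
    simpa [hx0] using ht

end LocalEstimate

/-! ### Transversality, compactness and the global estimate. -/

namespace Stratification

open Topology Filter

variable {L : FirstOrder.Language.{u, v}} [L.Structure ℝ] {m : ℕ} {X : Set (Euc m)}

theorem cornerSet_le {B : Set (Euc m)} {l : ℕ} {p : Euc m} (hp : p ∈ cornerSet B l) : l ≤ m := by
  obtain ⟨_, _, J, -, -, -, -, -, hJ, -⟩ := hp
  rw [← hJ]
  simpa using J.card_le_univ

/-- The estimate near a point of the boundary of `U`. -/
theorem exists_dist_le_local (hL : IsPolyBoundedOMinimal L) (hX : IsClosed X)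
    (𝒳 : Stratification L X) (h𝒳 : 𝒳.IsLipschitz) {U : Set (Euc m)} (hU : IsOpen U)
    (hUcorners : IsC2HypersurfaceWithCorners (frontier U))
    (htrans : ∀ l ≤ m, ∀ i ≤ m, TransverseSets (cornerSet (frontier U) l) (𝒳.stratum i))
    (k : ℕ) {p : Euc m} (hp : p ∈ frontier U) :
    ∃ δ > 0, ∃ Q : ℝ, ∀ x ∈ U, ∀ y ∈ 𝒳.skel k \ U, dist x p < δ → dist y p < δ →
      ∃ z ∈ U ∩ 𝒳.skel k, dist x z ≤ Q * dist x y := by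
  by_cases hpk : p ∈ 𝒳.skel k
  swap
  · obtain ⟨δ, hδ, hb⟩ := Metric.isOpen_iff.1 (𝒳.isClosed_skel hL hX k).isOpen_compl p hpk
    exact ⟨δ, hδ, 0, fun x _ y hy _ hyp => absurd hy.1 (hb hyp)⟩
  obtain ⟨i, hik, hpi⟩ := 𝒳.exists_mem_stratum_of_mem_skel hpk
  obtain ⟨l, hpl⟩ := hUcorners p hp
  have htop := htrans l (cornerSet_le hpl) i (𝒳.le_of_mem_stratum hpi) p ⟨hpl, hpi⟩
  obtain ⟨h, h', hh, hne, hker, hplus, hminus, hone⟩ := exists_sides hU hpl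
  -- `h'` kills the tangent space of the corner set; if it also killed that of the stratum,
  -- transversality would make it zero.
  obtain ⟨v, hv, hhv⟩ : ∃ v ∈ tangentSpaceOf (𝒳.stratum i) p, h' v ≠ 0 := by
    by_contra! hcon
    apply hne
    have hle : (⊤ : Submodule ℝ (Euc m)) ≤ LinearMap.ker h'.toLinearMap := by
      rw [← htop]
      exact sup_le (fun w hw => hker w hw) fun w hw => hcon w hw
    ext w
    exact hle (Submodule.mem_top (x := w))
  obtain ⟨v, hv, hhv⟩ : ∃ v ∈ tangentSpaceOf (𝒳.stratum i) p, 0 < h' v := by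
    rcases lt_or_gt_of_ne hhv with hlt | hlt
    · exact ⟨-v, Submodule.neg_mem _ hv, by simpa using hlt⟩
    · exact ⟨v, hv, hlt⟩
  rcases hone with hpos | hneg
  · exact exists_dist_le_of_side hh hhv
      (fun ε hε => 𝒳.exists_dist_add_smul_le hL hX h𝒳 k hpi hv hε) hpos hminus
  · exact exists_dist_le_of_side (v := -v) hh.neg (by simpa using hhv)
      (fun ε hε => 𝒳.exists_dist_add_smul_le hL hX h𝒳 k hpi (Submodule.neg_mem _ hv) hε)
      (by simpa using hneg) (by simpa using hplus)

/-- The estimate for a single skeleton. -/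
theorem exists_setDist_inducedSkel_le (hL : IsPolyBoundedOMinimal L) (hX : IsClosed X)
    (𝒳 : Stratification L X) (h𝒳 : 𝒳.IsLipschitz) {U : Set (Euc m)} (hU : IsOpen U)
    (hUcompact : IsCompact (frontier U)) (hUcorners : IsC2HypersurfaceWithCorners (frontier U))
    (htrans : ∀ l ≤ m, ∀ i ≤ m, TransverseSets (cornerSet (frontier U) l) (𝒳.stratum i)) (k : ℕ) :
    ∃ Q : ℝ, ∀ x ∈ U, setDist x (𝒳.inducedSkel U k) ≤ Q * setDist x (𝒳.skel k) := by
  rcases (𝒳.skel k).eq_empty_or_nonempty with hemp | hne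
  · refine ⟨1, fun x _ => ?_⟩
    rw [inducedSkel, hemp, inter_empty, one_mul]
  obtain ⟨δ, hδ, Q, H⟩ : ∃ δ > 0, ∃ Q : ℝ, ∀ p ∈ frontier U, ∀ x ∈ U, ∀ y ∈ 𝒳.skel k \ U,
      dist x p < δ → dist y p < δ → ∃ z ∈ U ∩ 𝒳.skel k, dist x z ≤ Q * dist x y := by
    refine hUcompact.induction_on (p := fun S => ∃ δ > 0, ∃ Q : ℝ, ∀ p ∈ S, ∀ x ∈ U,
      ∀ y ∈ 𝒳.skel k \ U, dist x p < δ → dist y p < δ →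
        ∃ z ∈ U ∩ 𝒳.skel k, dist x z ≤ Q * dist x y) ⟨1, one_pos, 0, by simp⟩ ?_ ?_ ?_
    · rintro S T hST ⟨δ, hδ, Q, H⟩
      exact ⟨δ, hδ, Q, fun p hp => H p (hST hp)⟩
    · rintro S T ⟨δ₁, hδ₁, Q₁, H₁⟩ ⟨δ₂, hδ₂, Q₂, H₂⟩
      refine ⟨min δ₁ δ₂, lt_min hδ₁ hδ₂, max Q₁ Q₂, fun p hp x hx y hy hxp hyp => ?_⟩
      rcases hp with hp | hp
      · obtain ⟨z, hz, hd⟩ := H₁ p hp x hx y hy (hxp.trans_le (min_le_left _ _))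
          (hyp.trans_le (min_le_left _ _))
        exact ⟨z, hz, hd.trans (mul_le_mul_of_nonneg_right (le_max_left _ _) dist_nonneg)⟩
      · obtain ⟨z, hz, hd⟩ := H₂ p hp x hx y hy (hxp.trans_le (min_le_right _ _))
          (hyp.trans_le (min_le_right _ _))
        exact ⟨z, hz, hd.trans (mul_le_mul_of_nonneg_right (le_max_right _ _) dist_nonneg)⟩
    · intro p hp
      obtain ⟨δ, hδ, Q, H⟩ := 𝒳.exists_dist_le_local hL hX h𝒳 hU hUcorners htrans k hp
      refine ⟨Metric.ball p (δ / 2), mem_nhdsWithin_of_mem_nhds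
        (Metric.ball_mem_nhds p (half_pos hδ)), δ / 2, half_pos hδ, Q, ?_⟩
      intro q hq x hx y hy hxq hyq
      rw [Metric.mem_ball] at hq
      exact H x hx y hy (by linarith [dist_triangle x q p]) (by linarith [dist_triangle y q p])
  obtain ⟨M, hM0, hM⟩ : ∃ M : ℝ, 1 ≤ M ∧ ∀ p ∈ frontier U,
      setDist p (𝒳.inducedSkel U k) ≤ M := by
    rcases (𝒳.inducedSkel U k).eq_empty_or_nonempty with hY | ⟨z, hz⟩
    · exact ⟨1, le_rfl, fun p _ => by rw [hY, setDist_empty]⟩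
    · obtain ⟨M, hM⟩ := hUcompact.isBounded.subset_closedBall z
      exact ⟨max 1 M, le_max_left _ _, fun p hp =>
        (setDist_le_dist p hz).trans ((hM hp).trans (le_max_right _ _))⟩
  -- `Q` serves when `x` is closer than `δ` to its nearest point `y ∉ U`: then the segment meets the
  -- frontier near both. Otherwise a frontier point on the segment gives the bound `dist x y + M`,
  -- and `M ≤ M / δ * dist x y`.
  refine ⟨max Q (1 + M / δ), fun x hx => ?_⟩
  obtain ⟨y, hy, hyd⟩ := exists_dist_eq_setDist x (𝒳.isClosed_skel hL hX k) hne
  rw [← hyd]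
  have hd0 : 0 ≤ dist x y := dist_nonneg
  have hMδ : 0 ≤ M / δ := by positivity
  have hQ1 : Q * dist x y ≤ max Q (1 + M / δ) * dist x y :=
    mul_le_mul_of_nonneg_right (le_max_left _ _) hd0
  have hQ2 : (1 + M / δ) * dist x y ≤ max Q (1 + M / δ) * dist x y :=
    mul_le_mul_of_nonneg_right (le_max_right _ _) hd0
  by_cases hyU : y ∈ U
  · refine le_trans ?_ hQ2
    have := setDist_le_dist x (S := 𝒳.inducedSkel U k) ⟨hyU, hy⟩
    nlinarith
  obtain ⟨p, hpseg, hpU⟩ : (segment ℝ x y ∩ frontier U).Nonempty := by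
    by_contra hemp
    rw [not_nonempty_iff_eq_empty, ← disjoint_iff_inter_eq_empty] at hemp
    rcases (convex_segment x y).isPreconnected.subset_or_disjoint_of_frontier hU hemp with h | h
    · exact hyU (h (right_mem_segment ℝ x y))
    · exact disjoint_left.1 h (left_mem_segment ℝ x y) hx
  have hsum := dist_add_dist_of_mem_segment hpseg
  have hpx : 0 ≤ dist x p := dist_nonneg
  have hpy : 0 ≤ dist p y := dist_nonneg
  rcases lt_or_ge (dist x y) δ with hlt | hge
  · obtain ⟨z, hz, hzd⟩ := H p hpU x hx y ⟨hy, hyU⟩ (by linarith)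
      (by rw [dist_comm]; linarith)
    exact (setDist_le_dist x hz).trans (hzd.trans hQ1)
  · refine le_trans ?_ hQ2
    have h1 := setDist_le_add x p (𝒳.inducedSkel U k)
    have h2 := hM p hpU
    have h3 : M ≤ M / δ * dist x y := by
      calc M = M / δ * δ := by field_simp
        _ ≤ M / δ * dist x y := mul_le_mul_of_nonneg_left hge hMδ
    linarith

end Stratification

theorem mainTheorem3 (L : FirstOrder.Language.{u, v}) [L.Structure ℝ]
    (hL : IsPolyBoundedOMinimal L) (m : ℕ)
    (X : Set (Euc m)) (hXclosed : IsClosed X) (hXdef : DefinableSet L X)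
    (𝒳 : Stratification L X) (h𝒳 : 𝒳.IsLipschitz)
    (U : Set (Euc m)) (hUopen : IsOpen U) (hUdef : DefinableSet L U)
    (hUcompact : IsCompact (frontier U)) (hUcorners : IsC2HypersurfaceWithCorners (frontier U))
    (htrans : ∀ l ≤ m, ∀ i ≤ m, TransverseSets (cornerSet (frontier U) l) (𝒳.stratum i)) :
    ∃ Q : ℝ, ∀ x ∈ U ∩ X, ∀ k : ℕ, k ≤ m →
      setDist x (𝒳.inducedSkel U k) ≤ Q * setDist x (𝒳.skel k) := by
  choose Q hQ using fun k : ℕ =>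
    𝒳.exists_setDist_inducedSkel_le hL hXclosed h𝒳 hUopen hUcompact hUcorners htrans k
  refine ⟨∑ k ∈ Finset.range (m + 1), |Q k|, fun x hx k hk => (hQ k x hx.1).trans ?_⟩
  refine mul_le_mul_of_nonneg_right ((le_abs_self _).trans ?_) (setDist_nonneg _ _)
  exact Finset.single_le_sum (f := fun k => |Q k|) (fun _ _ => abs_nonneg _)
    (Finset.mem_range.2 (Nat.lt_succ_of_le hk))
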